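/- **Setting.** Let $\Omega\subset\mathbb R^4$ be open, with coordinates $x^0,\dots,x^3$. A Cattaneo–Ferrarese (C.F.) coframe is $\theta^0=U\,dx^0+b_i\,dx^i$, $\theta^i=a^i_j\,dx^j$ ($i,j=1,2,3$) with $U\neq0$ and $(a^i_j)$ invertible; it defines the metric $g=-(\theta^0)^2+\sum_i(\theta^i)^2$. Let $e_\alpha$ be the dual frame and $\partial_\alpha=e_\alpha(\cdot)$ the Pfaff derivatives, i.e. $\partial_0=U^{-1}\partial/\partial x^0$, $\partial_i=A_i^j(\partial/\partial x^j-U^{-1}b_j\,\partial/\partial x^0)$ with $A=a^{-1}$. Let $\nabla_{e_\beta}e_\gamma=\omega_{\beta\gamma}^\alpha e_\alpha$ be the Levi-Civita connection, $R_{\alpha\beta,\lambda\mu}=g(R(e_\alpha,e_\beta)e_\mu,e_\lambda)$ the Riemann tensor and $R_{\mu\beta}=R_{\alpha\mu,}{}^{\alpha}{}_{\beta}$ the Ricci tensor. Put $Y_i=\omega_{00}^i$, $X_i^j=X_{ij}=\omega_{i0}^j$, $f_{ij}=\omega_{0i}^j$ (the rotation of the frame) and $c_{\alpha\beta}^\gamma=\omega_{\alpha\beta}^\gamma-\omega_{\beta\alpha}^\gamma$.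 A perfect fluid has a smooth equation of state $\mu=\mu(p,S)$, defined on an open set of pairs $(p,S)$ in which, for each $S$, the admissible $p$ form an interval. The fluid moves along the time lines, with velocity $u=e_0$. The Einstein–Euler equations are $$R_{\alpha\beta}=\rho_{\alpha\beta}:=(\mu+p)u_\alpha u_\beta+\tfrac12(\mu-p)g_{\alpha\beta},\qquad u^\alpha\partial_\alpha S=0,\qquad \nabla_\alpha\big[(\mu+p)u^\alpha u^\beta+p\,g^{\alpha\beta}\big]=0 .$$ Assume $\mu'_p>0$ and $\mu+p\neq0$ for all admissible $(p,S)$; then $p$ is a smooth function of $(\mu,S)$. **The EEF system.** The unknowns are $R_{\alpha\beta,\lambda\mu}$ ($36$ components: $\alpha\beta$ and $\lambda\mu$ run over the six pairs of distinct indices), $a^i_j$, $b_i$, $\omega_{ij}^h$, $X_{ij}$, $Y_i$, $\mu$, $S$ and $S_k$ (standing for $\partial_kS$). The functions $U\neq 0$ and $f_{ij}$ are prescribed arbitrarily. The derivatives $\partial_\alpha$ are built from $U,a,b$, and the connection coefficients are expressed by the unknowns through $\omega_{00}^0=\omega_{i0}^0=0$, $\omega_{00}^i=\omega_{0i}^0=Y_i$,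 $\omega_{0i}^j=f_{ij}$, $\omega_{i0}^j=\omega_{ij}^0=X_{ij}$. Write $$Q_{\lambda\mu}{}^{\alpha}{}_{\beta}=-\omega_{\rho\beta}^\alpha(\omega_{\lambda\mu}^\rho-\omega_{\mu\lambda}^\rho)+\omega_{\lambda\rho}^\alpha\omega_{\mu\beta}^\rho-\omega_{\mu\rho}^\alpha\omega_{\lambda\beta}^\rho ,$$ $$G_0=-X_i^i/\mu'_p,\qquad G_i=-Y_i,\qquad S_0=0,\qquad K_{\alpha\beta}=c_{\alpha\beta}^\gamma G_\gamma-\frac{\mu'_S}{\mu+p}(S_\alpha G_\beta-S_\beta G_\alpha).$$ Below, $\partial_\alpha p$, $\partial_\alpha\mu$ and $\partial_\alpha\mu'_p$ stand for $(\mu+p)G_\alpha$, $\mu'_p\,\partial_\alpha p+\mu'_S S_\alpha$ and $\mu''_{pp}\,\partial_\alpha p+\mu''_{pS}S_\alpha$ wherever they occur undifferentiated on the right-hand sides (in particular in $\nabla_\lambda\rho_{\mu i}$). The EEF system is, for all pairs $\lambda\mu$ and all spatial indices, $$\nabla_0R_{hk,\lambda\mu}+\nabla_kR_{0h,\lambda\mu}-\nabla_hR_{0k,\lambda\mu}=0,\qquad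 \nabla_0R^0{}_{i,\lambda\mu}+\nabla_hR^h{}_{i,\lambda\mu}=\nabla_\lambda\rho_{\mu i}-\nabla_\mu\rho_{\lambda i},$$ $$\partial_0a^i_j=a^k_j(X_{ki}-f_{ki}),\qquad \partial_0b_i=a^h_i(-Y_h+U^{-1}\partial_hU)+U^{-1}b_i\,\partial_0U,$$ $$\partial_0\omega_{hj}^i=\partial_hf_{ji}-Q_{0h}{}^i{}_j+R_{0h,ij},$$ $$\partial_0X_{hi}-\partial_iY_h=-K_{hi}+Q_{h0}{}^i{}_0-R_{h0,i0},$$ $$\mu'_p\,\partial_0Y_i-\partial_kX_{ik}=-\mu'_pK_{0i}+(\partial_i\mu'_p)\,G_0+Q_{ki}{}^k{}_0,$$ $$\partial_0\mu=-(\mu+p)X_i^i,\qquad \partial_0S=0,\qquad \partial_0S_k=(f_{kj}-X_{kj})S_j .$$ **Theorem.** 1. The EEF system is a quasi FOSH system. That is, there are functions $M^\alpha(v)$ with values in the square matrices and $B$ with values in the column vectors, which depend only on the equation of state, are smooth for $\det a\ne0$, $(\mu,S)$ in the range of $(p,S)\mapsto(\mu(p,S),S)$ and (for $B$) $U\neq0$,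 such that for arbitrary $U\ne 0$ and $f_{ij}$ the EEF system for the vector $v$ of all unknowns is equivalent to $$M^\alpha(v)\,\partial_\alpha v=B\big(U,\tfrac{\partial U}{\partial x},f,\tfrac{\partial f}{\partial x},v\big),$$ where all $M^\alpha$ are symmetric and $M^0$ is positive definite. 2. For every smooth solution $(U,a,b,p,S)$ of the Einstein–Euler equations on $\Omega$ in a C.F. frame whose time lines are the flow lines, with frame rotation $\omega_{0i}^j=f_{ij}$, the Riemann components, $a$, $b$, $\omega_{ij}^h$, $X_{ij}$, $Y_i$, $\mu$, $S$ and $\partial_kS$ satisfy the EEF system on $\Omega$ with this $U$ and $f$. -/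

import Mathlib

open scoped ContDiff

namespace EEF

/-! ## Conventions

Greek indices run over `Fin 4` (index `0` is the time index), Latin indices over `Fin 3`; the
spacetime index of the spatial index `i` is `i.succ`.  An array with several indices is written with
its indices in reading order: lower indices from left to right, then the upper one, so that
`ω α β γ` is `ω_{αβ}^γ`.  The signature is `(-,+,+,+)` and units are such that the Einstein equations
are `R_{αβ} - R g_{αβ} / 2 = T_{αβ}`. -/

/-- Points of the coordinate domain, with coordinates `x⁰, x¹, x², x³`. -/
abbrev Pt := Fin 4 → ℝ

/-- The partial derivative `∂g/∂x^m`. -/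
noncomputable def pd (m : Fin 4) (g : Pt → ℝ) (x : Pt) : ℝ := fderiv ℝ g x (Pi.single m 1)

/-- The diagonal entry `η_{αα}` of the Minkowski metric. -/
def eps (α : Fin 4) : ℝ := if α = 0 then -1 else 1

/-- The Minkowski metric `η_{αβ} = η^{αβ}`. -/
def eta (α β : Fin 4) : ℝ := if α = β then eps α else 0

/-! ## Cattaneo-Ferrarese frames -/

/-- The Cattaneo-Ferrarese coframe `θ⁰ = U dx⁰ + b_i dx^i`, `θ^i = a^i_j dx^j`;
`coframe U a b α m` is the `dx^m` coefficient of `θ^α`. -/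
def coframe (U : ℝ) (a : Fin 3 → Fin 3 → ℝ) (b : Fin 3 → ℝ) : Fin 4 → Fin 4 → ℝ :=
  Fin.cons (Fin.cons U b) fun i => Fin.cons 0 (a i)

/-- The dual frame `e_0 = U⁻¹ ∂/∂x⁰`, `e_i = A^j_i (∂/∂x^j - U⁻¹ b_j ∂/∂x⁰)`, where `A = a⁻¹`;
`frame U a b α m` is the `∂/∂x^m` component of `e_α`. -/
noncomputable def frame (U : ℝ) (a : Fin 3 → Fin 3 → ℝ) (b : Fin 3 → ℝ) : Fin 4 → Fin 4 → ℝ :=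
  Fin.cons (Fin.cons U⁻¹ fun _ => 0) fun i =>
    Fin.cons (-(U⁻¹ * ∑ j, (Matrix.of a)⁻¹ j i * b j)) fun j => (Matrix.of a)⁻¹ j i

/-- `frame` is the frame dual to `coframe`. -/
theorem coframe_frame (U : ℝ) (a : Fin 3 → Fin 3 → ℝ) (b : Fin 3 → ℝ) (hU : U ≠ 0)
    (ha : (Matrix.of a).det ≠ 0) (α β : Fin 4) :
    ∑ m, coframe U a b α m * frame U a b β m = if α = β then 1 else 0 := by
  have hinv : Matrix.of a * (Matrix.of a)⁻¹ = 1 :=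
    Matrix.mul_nonsing_inv _ (isUnit_iff_ne_zero.mpr ha)
  rw [Fin.sum_univ_succ]
  induction α using Fin.cases with
  | zero =>
    induction β using Fin.cases with
    | zero => simp [coframe, frame, hU]
    | succ j =>
      have : (0 : Fin 4) ≠ j.succ := (Fin.succ_ne_zero j).symm
      simp [coframe, frame, this, hU]
      rw [← sub_eq_zero]
      simp [mul_comm]
  | succ i =>
    induction β using Fin.cases with
    | zero => simp [coframe, frame]
    | succ j =>
      have := congrFun (congrFun hinv i) j
      simp only [Matrix.mul_apply, Matrix.of_apply, Matrix.one_apply] at this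
      simp [coframe, frame, this]

/-- The Pfaff derivative `∂_α g = e_α(g)` at `x`, for a frame with components `e` at `x`. -/
noncomputable def pfaff (e : Fin 4 → Fin 4 → ℝ) (α : Fin 4) (g : Pt → ℝ) (x : Pt) : ℝ :=
  ∑ m, e α m * pd m g x

/-! ## Connection and curvature of the metric `g = η_{αβ} θ^α θ^β` in an orthonormal frame -/

/-- The structure coefficients `c_{βγ}^α = -dθ^α(e_β, e_γ)` of a coframe `θ` with dual frame `e`,
so that `dθ^α = -½ c_{βγ}^α θ^β ∧ θ^γ`. -/
noncomputable def structCoeff (θ e : Pt → Fin 4 → Fin 4 → ℝ) (x : Pt) (β γ α : Fin 4) : ℝ :=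
  -∑ m, ∑ n, (pd m (fun y => θ y α n) x - pd n (fun y => θ y α m) x) * e x β m * e x γ n

/-- The coefficients `ω_{αλ}^μ` of the Levi-Civita connection, `∇_{e_α} e_λ = ω_{αλ}^μ e_μ`, from
`ω_{αλ,μ} = ½ (c_{αλ,μ} - c_{αμ,λ} - c_{λμ,α})`, the last index being lowered with `η`. -/
noncomputable def leviCivita (θ e : Pt → Fin 4 → Fin 4 → ℝ) (x : Pt) (α l μ : Fin 4) : ℝ :=
  eps μ * ((1 / 2) * (eps μ * structCoeff θ e x α l μ - eps l * structCoeff θ e x α μ l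
    - eps α * structCoeff θ e x l μ α))

theorem eps_mul_self (α : Fin 4) : eps α * eps α = 1 := by
  unfold eps; split_ifs <;> norm_num

theorem structCoeff_antisymm (θ e : Pt → Fin 4 → Fin 4 → ℝ) (x : Pt) (β γ α : Fin 4) :
    structCoeff θ e x β γ α = -structCoeff θ e x γ β α := by
  unfold structCoeff
  rw [Finset.sum_comm]
  simp only [← Finset.sum_neg_distrib]
  refine Finset.sum_congr rfl fun m _ => Finset.sum_congr rfl fun n _ => ?_
  ring

/-- The connection `leviCivita` is torsion free. -/
theorem leviCivita_torsion (θ e : Pt → Fin 4 → Fin 4 → ℝ) (x : Pt) (β γ α : Fin 4) :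
    leviCivita θ e x β γ α - leviCivita θ e x γ β α = structCoeff θ e x β γ α := by
  have h := eps_mul_self α
  have h1 := structCoeff_antisymm θ e x γ β α
  unfold leviCivita
  rw [h1]
  linear_combination structCoeff θ e x β γ α * h

/-- The connection `leviCivita` is metric. -/
theorem leviCivita_metric (θ e : Pt → Fin 4 → Fin 4 → ℝ) (x : Pt) (γ β l : Fin 4) :
    eps l * leviCivita θ e x γ β l + eps β * leviCivita θ e x γ l β = 0 := by
  have h1 := structCoeff_antisymm θ e x β l γ
  unfold leviCivita
  have h2 := eps_mul_self l
  have h3 := eps_mul_self β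
  rw [h1]
  linear_combination
    (1 / 2) * (eps l * structCoeff θ e x γ β l - eps β * structCoeff θ e x γ l β
      + eps γ * structCoeff θ e x l β γ) * (h2 - h3)

/-- The Levi-Civita connection coefficients of a Cattaneo-Ferrarese frame. -/
noncomputable def cfConn (U : Pt → ℝ) (a : Pt → Fin 3 → Fin 3 → ℝ) (b : Pt → Fin 3 → ℝ) :
    Pt → Fin 4 → Fin 4 → Fin 4 → ℝ :=
  leviCivita (fun y => coframe (U y) (a y) (b y)) (fun y => frame (U y) (a y) (b y))

/-- The part of the curvature that is quadratic in the connection,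
`-ω_{ρβ}^α (ω_{λμ}^ρ - ω_{μλ}^ρ) + ω_{λρ}^α ω_{μβ}^ρ - ω_{μρ}^α ω_{λβ}^ρ`. -/
def quadCurv (w : Fin 4 → Fin 4 → Fin 4 → ℝ) (l μ α β : Fin 4) : ℝ :=
  ∑ r, (-(w r β α * (w l μ r - w μ l r)) + w l r α * w μ β r - w μ r α * w l β r)

/-- The Riemann tensor `R_{λμ}{}^α{}_β` of a connection given in a frame with components `e`. -/
noncomputable def riemannUp (e : Pt → Fin 4 → Fin 4 → ℝ) (w : Pt → Fin 4 → Fin 4 → Fin 4 → ℝ)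
    (x : Pt) (l μ α β : Fin 4) : ℝ :=
  pfaff (e x) l (fun y => w y μ β α) x - pfaff (e x) μ (fun y => w y l β α) x
    + quadCurv (w x) l μ α β

/-- The Riemann tensor with all indices lowered, `R_{λμ,αβ}`. -/
noncomputable def riemannDown (e : Pt → Fin 4 → Fin 4 → ℝ)
    (w : Pt → Fin 4 → Fin 4 → Fin 4 → ℝ) (x : Pt) (l μ α β : Fin 4) : ℝ :=
  eps α * riemannUp e w x l μ α β

/-- The Ricci tensor `R_{μβ} = R_{αμ}{}^α{}_β`. -/
noncomputable def ricci (e : Pt → Fin 4 → Fin 4 → ℝ) (w : Pt → Fin 4 → Fin 4 → Fin 4 → ℝ)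
    (x : Pt) (μ β : Fin 4) : ℝ :=
  ∑ α, riemannUp e w x α μ α β

/-! ## Perfect fluids -/

/-- An equation of state: the energy density `μ(p, S)`, a smooth function of pressure and entropy
on an open set `dom` of admissible pairs `(p, S)`; for each `S` the admissible pressures form an
interval. -/
structure EquationOfState where
  dom : Set (ℝ × ℝ)
  isOpen_dom : IsOpen dom
  ordConnected_dom : ∀ s : ℝ, {p : ℝ | (p, s) ∈ dom}.OrdConnected
  mu : ℝ → ℝ → ℝ
  smooth_mu : ContDiffOn ℝ ∞ (fun q : ℝ × ℝ => mu q.1 q.2) dom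

namespace EquationOfState

variable (E : EquationOfState)

/-- `μ'_p` -/
noncomputable def muP (p s : ℝ) : ℝ := deriv (fun p' => E.mu p' s) p
/-- `μ'_S` -/
noncomputable def muS (p s : ℝ) : ℝ := deriv (fun s' => E.mu p s') s
/-- `μ''_{pp}` -/
noncomputable def muPP (p s : ℝ) : ℝ := deriv (fun p' => E.muP p' s) p
/-- `μ''_{pS}` -/
noncomputable def muPS (p s : ℝ) : ℝ := deriv (fun s' => E.muP p s') s

/-- The admissible pressure with `μ(p, s) = m` (unique when `μ'_p > 0`). -/
noncomputable def pressure (m s : ℝ) : ℝ :=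
  Function.invFunOn (fun p => E.mu p s) {p : ℝ | (p, s) ∈ E.dom} m

end EquationOfState

/-- The frame components `u^α` of the fluid velocity: the flow lines are the time lines and
`u = e_0`. -/
def velocity (α : Fin 4) : ℝ := if α = 0 then 1 else 0

/-- `T^{αβ} = (μ + p) u^α u^β + p g^{αβ}` in the frame. -/
def stressEnergy (m p : ℝ) (α β : Fin 4) : ℝ :=
  (m + p) * velocity α * velocity β + p * eta α β

/-- `ρ_{αβ} = (μ + p) u_α u_β + ½ (μ - p) g_{αβ}` in the frame. -/
noncomputable def rho (m p : ℝ) (α β : Fin 4) : ℝ :=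
  (m + p) * (eps α * velocity α) * (eps β * velocity β) + (1 / 2) * (m - p) * eta α β

/-- `ρ_{αβ} = T_{αβ} - ½ T^γ_γ g_{αβ}`. -/
theorem rho_eq (m p : ℝ) (α β : Fin 4) :
    rho m p α β = eps α * eps β * stressEnergy m p α β
      - (1 / 2) * (∑ γ, eps γ * stressEnergy m p γ γ) * eta α β := by
  fin_cases α <;> fin_cases β <;>
    simp [rho, stressEnergy, velocity, eta, eps, Fin.sum_univ_succ] <;> ring

/-- A smooth solution `(U, a, b, p, S)` on `Ω` of the Einstein-Euler equations for a perfect fluid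
with equation of state `E`, written in a Cattaneo-Ferrarese frame whose time lines are the flow lines
of the fluid. -/
structure IsEinsteinEuler (E : EquationOfState) (Ω : Set Pt) (U : Pt → ℝ)
    (a : Pt → Fin 3 → Fin 3 → ℝ) (b : Pt → Fin 3 → ℝ) (p S : Pt → ℝ) : Prop where
  smooth_U : ContDiffOn ℝ ∞ U Ω
  smooth_a : ContDiffOn ℝ ∞ a Ω
  smooth_b : ContDiffOn ℝ ∞ b Ω
  smooth_p : ContDiffOn ℝ ∞ p Ω
  smooth_S : ContDiffOn ℝ ∞ S Ω
  lapse_ne_zero : ∀ x ∈ Ω, U x ≠ 0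
  det_ne_zero : ∀ x ∈ Ω, (Matrix.of (a x)).det ≠ 0
  mem_dom : ∀ x ∈ Ω, (p x, S x) ∈ E.dom
  /-- `R_{αβ} = ρ_{αβ}` -/
  einstein : ∀ x ∈ Ω, ∀ α β,
    ricci (fun y => frame (U y) (a y) (b y)) (cfConn U a b) x α β
      = rho (E.mu (p x) (S x)) (p x) α β
  /-- `u^α ∂_α S = 0` -/
  entropy : ∀ x ∈ Ω, ∑ α, velocity α * pfaff (frame (U x) (a x) (b x)) α S x = 0
  /-- `∇_α T^{αβ} = 0` -/
  euler : ∀ x ∈ Ω, ∀ β,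
    ∑ α, (pfaff (frame (U x) (a x) (b x)) α
          (fun y => stressEnergy (E.mu (p y) (S y)) (p y) α β) x
        + ∑ γ, (cfConn U a b x α γ α * stressEnergy (E.mu (p x) (S x)) (p x) γ β
          + cfConn U a b x α γ β * stressEnergy (E.mu (p x) (S x)) (p x) α γ)) = 0

/-! ## The unknowns -/

/-- Labels of the pairs of distinct spacetime indices: `inl 0, inl 1, inl 2` stand for
`01, 02, 03` and `inr 0, inr 1, inr 2` for `23, 31, 12`. -/
abbrev Pair := Fin 3 ⊕ Fin 3

/-- First index of a pair. -/
def Pair.fst : Pair → Fin 4 := Sum.elim (fun _ => 0) ![2, 3, 1]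

/-- Second index of a pair. -/
def Pair.snd : Pair → Fin 4 := Sum.elim ![1, 2, 3] ![3, 1, 2]

/-- The antisymmetric array with given components on the pairs. -/
def ofPairs (φ : Pair → ℝ) : Fin 4 → Fin 4 → ℝ :=
  ![![0, φ (.inl 0), φ (.inl 1), φ (.inl 2)],
    ![-φ (.inl 0), 0, φ (.inr 2), -φ (.inr 1)],
    ![-φ (.inl 1), -φ (.inr 2), 0, φ (.inr 0)],
    ![-φ (.inl 2), φ (.inr 1), -φ (.inr 0), 0]]

/-- An antisymmetric array is recovered from its components on the pairs. -/
theorem ofPairs_eq (t : Fin 4 → Fin 4 → ℝ) (h : ∀ α β, t α β = -t β α) :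
    ofPairs (fun P => t P.fst P.snd) = t := by
  have hd : ∀ α, t α α = 0 := fun α => by linarith [h α α]
  funext α β
  fin_cases α <;> fin_cases β <;> simp [ofPairs, Pair.fst, Pair.snd, hd] <;>
    exact (h _ _).symm

/-- Labels of the scalar unknowns: `R P Q` is the component `R_{αβ,λμ}` with `αβ` the pair `P` and
`λμ` the pair `Q`; `a i j` is `a^i_j`; `b i` is `b_i`; `w i j h` is `ω_{ij}^h`; `X i j` is
`X_i^j = ω_{i0}^j`; `Y i` is `Y_i = ω_{00}^i`; `mu` is the density, `S` the entropy and `dS k`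
is `S_k = ∂_k S`. -/
inductive Idx where
  | R (P Q : Pair)
  | a (i j : Fin 3)
  | b (i : Fin 3)
  | w (i j h : Fin 3)
  | X (i j : Fin 3)
  | Y (i : Fin 3)
  | mu
  | S
  | dS (k : Fin 3)
  deriving DecidableEq, Fintype

/-- A value of the unknowns. -/
abbrev State := Idx → ℝ

namespace State

variable (E : EquationOfState) (z : State)

/-- The frame determined by the lapse and the frame coefficients of a state. -/
noncomputable def frame (U : ℝ) : Fin 4 → Fin 4 → ℝ :=
  EEF.frame U (fun i j => z (.a i j)) (fun i => z (.b i))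

/-- The full tensor `R_{αβ,λμ}` of a state. -/
def riem (α β l μ : Fin 4) : ℝ := ofPairs (fun P => ofPairs (fun Q => z (.R P Q)) l μ) α β

/-- All connection coefficients `ω_{αβ}^γ` of a state, with `ω_{0i}^j = f_{ij}`:
`ω_{00}^0 = ω_{i0}^0 = 0`, `ω_{00}^i = ω_{0i}^0 = Y_i`, `ω_{i0}^j = ω_{ij}^0 = X_{ij}`. -/
def conn (f : Fin 3 → Fin 3 → ℝ) : Fin 4 → Fin 4 → Fin 4 → ℝ :=
  Fin.cons
    (Fin.cons (Fin.cons 0 fun i => z (.Y i)) fun i => Fin.cons (z (.Y i)) (f i))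
    fun i => Fin.cons (Fin.cons 0 fun j => z (.X i j))
      fun j => Fin.cons (z (.X i j)) fun h => z (.w i j h)

/-- `c_{αβ}^γ = ω_{αβ}^γ - ω_{βα}^γ` -/
def comm (f : Fin 3 → Fin 3 → ℝ) (α β γ : Fin 4) : ℝ := z.conn f α β γ - z.conn f β α γ

/-- The pressure as a function of density and entropy. -/
noncomputable def pressure : ℝ := E.pressure (z .mu) (z .S)

/-- `μ'_p` -/
noncomputable def muP : ℝ := E.muP (z.pressure E) (z .S)

/-- `X_i^i` -/
def trX : ℝ := ∑ i, z (.X i i)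

/-- The values of `G_α = ∂_α p / (μ + p)` given by the Euler equations:
`G_0 = -X_i^i / μ'_p`, `G_i = -Y_i`. -/
noncomputable def G : Fin 4 → ℝ := Fin.cons (-(z.trX / z.muP E)) fun i => -z (.Y i)

/-- The values of `∂_α p = (μ + p) G_α`. -/
noncomputable def dp (α : Fin 4) : ℝ := (z .mu + z.pressure E) * z.G E α

/-- The values of `∂_α S`: `∂_0 S = 0`, `∂_i S = S_i`. -/
def dS : Fin 4 → ℝ := Fin.cons 0 fun k => z (.dS k)

/-- The values of `∂_α μ = μ'_p ∂_α p + μ'_S ∂_α S`. -/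
noncomputable def dmu (α : Fin 4) : ℝ :=
  z.muP E * z.dp E α + E.muS (z.pressure E) (z .S) * z.dS α

/-- The values of `∂_α μ'_p = μ''_{pp} ∂_α p + μ''_{pS} ∂_α S`. -/
noncomputable def dmuP (α : Fin 4) : ℝ :=
  E.muPP (z.pressure E) (z .S) * z.dp E α + E.muPS (z.pressure E) (z .S) * z.dS α

/-- The values of `∂_α G_β - ∂_β G_α`, from the commutation relation
`(∂_α ∂_β - ∂_β ∂_α) p = c_{αβ}^γ ∂_γ p`; the last term vanishes for a constant entropy. -/
noncomputable def curlG (f : Fin 3 → Fin 3 → ℝ) (α β : Fin 4) : ℝ :=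
  ∑ γ, z.comm f α β γ * z.G E γ
    - E.muS (z.pressure E) (z .S) / (z .mu + z.pressure E)
      * (z.dS α * z.G E β - z.dS β * z.G E α)

/-- The values of `∇_α ρ_{βγ}`; since `rho` is linear in `(μ, p)`, `∂_α ρ_{βγ}` is
`rho (∂_α μ) (∂_α p) β γ`. -/
noncomputable def nablaRho (f : Fin 3 → Fin 3 → ℝ) (α β γ : Fin 4) : ℝ :=
  rho (z.dmu E α) (z.dp E α) β γ
    - ∑ s, (z.conn f α β s * rho (z .mu) (z.pressure E) s γ
      + z.conn f α γ s * rho (z .mu) (z.pressure E) β s)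

/-- The values of the source `J_{i,λμ} = ∇_λ ρ_{μi} - ∇_μ ρ_{λi}` of the Bianchi equations. -/
noncomputable def sourceJ (f : Fin 3 → Fin 3 → ℝ) (i l μ : Fin 4) : ℝ :=
  z.nablaRho E f l μ i - z.nablaRho E f μ l i

/-- `∇_α R_{βγ,λμ}`, where `d α` is the array of the Pfaff derivatives `∂_α` of the unknowns. -/
def nablaRiem (f : Fin 3 → Fin 3 → ℝ) (d : Fin 4 → State) (α β γ l μ : Fin 4) : ℝ :=
  riem (d α) β γ l μ
    - ∑ s, (z.conn f α β s * z.riem s γ l μ + z.conn f α γ s * z.riem β s l μ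
      + z.conn f α l s * z.riem β γ s μ + z.conn f α μ s * z.riem β γ l s)

end State

/-- The Pfaff derivatives `∂_α` of all unknowns of a field `v` of states, in the frame determined by
`U` and by the frame coefficients contained in `v`. -/
noncomputable def pfaffState (U : Pt → ℝ) (v : Pt → State) (x : Pt) (α : Fin 4) : State :=
  fun I => pfaff ((v x).frame (U x)) α (fun y => v y I) x

/-! ## The EEF system -/

/-- The Einstein-Euler-Friedrich system at the point `x`, for the unknowns `v`, with lapse `U` and
frame rotation `f` given (`f x i j` is `f_{ij} = ω_{0i}^j`). -/
structure EEFSystem (E : EquationOfState) (U : Pt → ℝ) (f : Pt → Fin 3 → Fin 3 → ℝ)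
    (v : Pt → State) (x : Pt) : Prop where
  /-- `∇_0 R_{hk,λμ} + ∇_k R_{0h,λμ} - ∇_h R_{0k,λμ} = 0` -/
  bianchi : ∀ (Q : Pair) (h k : Fin 3),
    (v x).nablaRiem (f x) (pfaffState U v x) 0 h.succ k.succ Q.fst Q.snd
      + (v x).nablaRiem (f x) (pfaffState U v x) k.succ 0 h.succ Q.fst Q.snd
      - (v x).nablaRiem (f x) (pfaffState U v x) h.succ 0 k.succ Q.fst Q.snd = 0
  /-- `∇_0 R^0_{i,λμ} + ∇_h R^h_{i,λμ} = J_{i,λμ}` -/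
  bianchi_contracted : ∀ (Q : Pair) (i : Fin 3),
    -(v x).nablaRiem (f x) (pfaffState U v x) 0 0 i.succ Q.fst Q.snd
      + ∑ h : Fin 3, (v x).nablaRiem (f x) (pfaffState U v x) h.succ h.succ i.succ Q.fst Q.snd
      = (v x).sourceJ E (f x) i.succ Q.fst Q.snd
  /-- `∂_0 a^i_j = -a^k_j c_{0k}^i = a^k_j (X_k^i - f_{ki})` -/
  frame_a : ∀ i j : Fin 3, pfaffState U v x 0 (.a i j)
    = ∑ k : Fin 3, v x (.a k j) * (v x (.X k i) - f x k i)
  /-- `∂_0 b_i = a^h_i (-Y_h + U⁻¹ ∂_h U) + U⁻¹ b_i ∂_0 U` -/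
  frame_b : ∀ i : Fin 3, pfaffState U v x 0 (.b i)
    = (∑ h : Fin 3, v x (.a h i)
        * (-v x (.Y h) + (U x)⁻¹ * pfaff ((v x).frame (U x)) h.succ U x))
      + (U x)⁻¹ * v x (.b i) * pfaff ((v x).frame (U x)) 0 U x
  /-- the expression of `R_{0h}{}^i{}_j` through the connection -/
  connection_w : ∀ h j i : Fin 3,
    pfaffState U v x 0 (.w h j i)
        - pfaff ((v x).frame (U x)) h.succ (fun y => f y j i) x
        + quadCurv ((v x).conn (f x)) 0 h.succ i.succ j.succ
      = (v x).riem 0 h.succ i.succ j.succ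
  /-- the expression of `R_{h0}{}^i{}_0` through the connection, in which `∂_h Y_i` is replaced by
  `∂_i Y_h - (∂_h G_i - ∂_i G_h)` -/
  connection_X : ∀ h i : Fin 3,
    pfaffState U v x 0 (.X h i) - pfaffState U v x i.succ (.Y h)
      = -(v x).curlG E (f x) h.succ i.succ
        + quadCurv ((v x).conn (f x)) h.succ 0 i.succ 0
        - (v x).riem h.succ 0 i.succ 0
  /-- the equation `μ'_p (∂_0 Y_i + ∂_0 G_i - ∂_i G_0) - ∂_i μ'_p G_0 - ∂_i X_k^k = 0`, with the
  commutator value of `∂_0 G_i - ∂_i G_0`, in which `∂_i X_k^k` is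
  replaced by its expression drawn from `R_{i0} = 0` -/
  connection_Y : ∀ i : Fin 3,
    (v x).muP E * pfaffState U v x 0 (.Y i) - ∑ k : Fin 3, pfaffState U v x k.succ (.X i k)
      = -((v x).muP E * (v x).curlG E (f x) 0 i.succ)
        + (v x).dmuP E i.succ * (v x).G E 0
        + ∑ k : Fin 3, quadCurv ((v x).conn (f x)) k.succ i.succ k.succ 0
  /-- `∂_0 μ + (μ + p) X_i^i = 0` -/
  matter_mu : pfaffState U v x 0 .mu + (v x .mu + (v x).pressure E) * (v x).trX = 0
  /-- `∂_0 S = 0` -/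
  matter_S : pfaffState U v x 0 .S = 0
  /-- `∂_0 S_k = c_{0k}^j S_j = (f_{kj} - X_k^j) S_j` -/
  matter_dS : ∀ k : Fin 3, pfaffState U v x 0 (.dS k)
    = ∑ j : Fin 3, (f x k j - v x (.X k j)) * v x (.dS j)

/-! ## Quasi FOSH systems -/

/-- The states at which the system makes sense: the frame is nondegenerate, and `(μ, S)` is of the
form `(μ(p, S), S)` with `(p, S)` admissible for the equation of state. -/
def admissible (E : EquationOfState) : Set State :=
  {z | (Matrix.of fun i j => z (.a i j)).det ≠ 0 ∧ ∃ p, (p, z .S) ∈ E.dom ∧ E.mu p (z .S) = z .mu}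

/-- Values of the gauge functions and of their first partial derivatives:
`(U, (∂U/∂x^m)_m, (f_{ij})_{ij}, (∂f_{ij}/∂x^m)_{mij})`. -/
abbrev GaugeJet :=
  ℝ × (Fin 4 → ℝ) × (Fin 3 → Fin 3 → ℝ) × (Fin 4 → Fin 3 → Fin 3 → ℝ)

/-- The values at `x` of the gauge functions and of their first partial derivatives. -/
noncomputable def gaugeJet (U : Pt → ℝ) (f : Pt → Fin 3 → Fin 3 → ℝ) (x : Pt) : GaugeJet :=
  (U x, fun m => pd m U x, f x, fun m i j => pd m (fun y => f y i j) x)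

/-- A system of equations `Sys U f v x` for the unknowns `v`, with arbitrary gauge functions `U`, `f`,
is quasi FOSH (first order symmetric hyperbolic in the Pfaff derivatives) on the set `adm` of states
if it is `M^α(v) ∂_α v = B(U, f, v)`, where `∂_α` are the Pfaff derivatives, `M^α` and `B` are smooth
functions of the unknowns and (for `B`) of the gauge functions and their first derivatives, the
matrices `M^α` are symmetric and `M^0` is positive definite. -/
def IsQuasiFOSH (adm : Set State)
    (Sys : (Pt → ℝ) → (Pt → Fin 3 → Fin 3 → ℝ) → (Pt → State) → Pt → Prop) : Prop :=
  ∃ (M : Fin 4 → State → Matrix Idx Idx ℝ) (B : GaugeJet → State → State),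
    (∀ α I J, ContDiffOn ℝ ∞ (fun z => M α z I J) adm) ∧
    (∀ I, ContDiffOn ℝ ∞ (fun q : GaugeJet × State => B q.1 q.2 I)
      {q | q.1.1 ≠ 0 ∧ q.2 ∈ adm}) ∧
    (∀ z ∈ adm, ∀ α, (M α z).IsSymm) ∧
    (∀ z ∈ adm, (M 0 z).PosDef) ∧
    ∀ (U : Pt → ℝ) (f : Pt → Fin 3 → Fin 3 → ℝ) (v : Pt → State) (x : Pt),
      U x ≠ 0 → v x ∈ adm →
      (Sys U f v x ↔
        ∑ α, (M α (v x)).mulVec (pfaffState U v x α) = B (gaugeJet U f x) (v x))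

/-! ## The unknowns of the EEF system determined by a fluid spacetime -/

/-- The components of the Riemann tensor, the frame and connection coefficients, the density, the
entropy and its space derivatives, for the metric defined by a Cattaneo-Ferrarese frame and a fluid
with pressure `p` and entropy `S`. -/
noncomputable def unknowns (E : EquationOfState) (U : Pt → ℝ) (a : Pt → Fin 3 → Fin 3 → ℝ)
    (b : Pt → Fin 3 → ℝ) (p S : Pt → ℝ) (x : Pt) : State
  | .R P Q => riemannDown (fun y => frame (U y) (a y) (b y)) (cfConn U a b) x P.fst P.snd Q.fst Q.snd
  | .a i j => a x i j
  | .b i => b x i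
  | .w i j h => cfConn U a b x i.succ j.succ h.succ
  | .X i j => cfConn U a b x i.succ 0 j.succ
  | .Y i => cfConn U a b x 0 0 i.succ
  | .mu => E.mu (p x) (S x)
  | .S => S x
  | .dS k => pfaff (frame (U x) (a x) (b x)) k.succ S x

end EEF

/-! Statement 2 is moving-frame geometry. Duality of frame and coframe yields the commutators of the
Pfaff derivatives and the Jacobi identity for the structure coefficients. Together with zero torsion
and the metric condition these give every curvature identity needed: both antisymmetries, pair
symmetry, the second Bianchi identity (`nabla4_second_bianchi`) and its contraction
(`contracted_bianchi`), where the Einstein equations turn Ricci into ρ. All this is algebra, so it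
is done for commuting derivations of a commutative ℝ-algebra and then applied to the smooth
functions on Ω; `Represents` translates between elements of that algebra and functions of points.
The equations for a and b are the coefficients c_{0k}^i and c_{0k}^0 written out, and the one for
ω_{hj}^i is the definition of the curvature.

The fluid enters through G_α = ∂_α p/(μ+p). The Euler equations say G_i = -Y_i and, since ∂_0 S = 0,
μ'_p G_0 = -X_k^k. As G is a multiple of a gradient, its curl is the algebraic expression K
(`curlG_unknowns`). This allows ∂_h Y_i in R_{h0}{}^i{}_0 to be traded for ∂_i Y_h, and, through the
derivative of μ'_p G_0 = -X_k^k (`pfaff_trX`), ∂_i X_k^k in R_{i0} = 0 to be traded for μ'_p ∂_0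
Y_i. After these exchanges the principal parts are ∂_0 X_{hi} - ∂_i Y_h and μ'_p ∂_0 Y_h - ∂_i
X_{hi}, a symmetric block.

Statement 1 is then linear algebra at one point. For each fixed second pair λμ the components
R_{0i,λμ} and R_{hk,λμ} obey equations of Maxwell type, whose principal part is symmetric; the X, Y
block is symmetric by the above; every other equation contains only ∂_0 in its principal part. Thus
M^0 is diagonal with entries 1 and μ'_p > 0, and the spatial matrices are constant. For smoothness,
p is a smooth function of (μ,S) by the inverse function theorem, strict monotonicity of μ in p
making the local inverse the global one (`contDiffAt_pressure`); the other denominators are μ'_p,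
μ+p, U and det a. -/

namespace EEF

/-! ### Algebra of frame derivations: brackets, Jacobi identity, curvature identities -/

section FrameCalculus

variable {A : Type*} [CommRing A] [Algebra ℝ A]

/-- The commutation relation of frame derivations with structure coefficients `c`. -/
def Commutes (D : Fin 4 → Derivation ℝ A A) (c : Fin 4 → Fin 4 → Fin 4 → A) : Prop :=
  ∀ α β g, D α (D β g) - D β (D α g) = ∑ γ, c α β γ * D γ g

/-- The Jacobi identity for structure coefficients. -/
def Jacobi (D : Fin 4 → Derivation ℝ A A) (c : Fin 4 → Fin 4 → Fin 4 → A) : Prop :=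
  ∀ α β γ δ, (D α (c β γ δ) + ∑ r, c β γ r * c α r δ)
    + (D β (c γ α δ) + ∑ r, c γ α r * c β r δ)
    + (D γ (c α β δ) + ∑ r, c α β r * c γ r δ) = 0

/-- The frame derivations `e_α = e_α^m ∂_m`. -/
def frameDer (P : Fin 4 → Derivation ℝ A A) (e : Fin 4 → Fin 4 → A) (α : Fin 4) :
    Derivation ℝ A A := ∑ m, e α m • P m

theorem frameDer_apply (P : Fin 4 → Derivation ℝ A A) (e : Fin 4 → Fin 4 → A) (α : Fin 4)
    (g : A) : frameDer P e α g = ∑ m, e α m * P m g := by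
  simp [frameDer, Fin.sum_univ_four]

/-- The structure coefficients of a coframe `θ` with dual frame `e`. -/
def structC (P : Fin 4 → Derivation ℝ A A) (θ e : Fin 4 → Fin 4 → A) (β γ α : Fin 4) : A :=
  -∑ m, ∑ n, (P m (θ α n) - P n (θ α m)) * e β m * e γ n

variable {P : Fin 4 → Derivation ℝ A A} {θ e : Fin 4 → Fin 4 → A}

/-- Differentiating the constant pairing θ^α(e_γ) moves the derivative from the coframe to the frame
with a sign; thus -dθ^α(e_β, e_γ) is the θ^α component of the bracket [e_β, e_γ]. -/
theorem structC_eq (hdual : ∀ α β, ∑ m, θ α m * e β m = if α = β then 1 else 0)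
    (β γ α : Fin 4) : structC P θ e β γ α
      = ∑ n, θ α n * (frameDer P e β (e γ n) - frameDer P e γ (e β n)) := by
  have key : ∀ β γ, ∑ n, θ α n * frameDer P e β (e γ n)
      = -∑ n, frameDer P e β (θ α n) * e γ n := by
    intro β γ
    have h := congrArg (frameDer P e β) (hdual α γ)
    have h0 : frameDer P e β (if α = γ then 1 else 0) = 0 := by split_ifs <;> simp
    rw [h0, map_sum] at h
    simp only [Derivation.leibniz, smul_eq_mul, Finset.sum_add_distrib] at h
    rw [eq_neg_iff_add_eq_zero, ← h]
    simp only [mul_comm]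
  simp only [mul_sub, Finset.sum_sub_distrib]
  rw [key β γ, key γ β]
  simp only [structC, frameDer_apply, Fin.sum_univ_four]
  ring

/-- The second duality relation rebuilds the bracket [e_β, e_γ] from its components along the frame.
-/
theorem structC_frame (hdual : ∀ α β, ∑ m, θ α m * e β m = if α = β then 1 else 0)
    (hdual' : ∀ m n, ∑ α, e α m * θ α n = if m = n then 1 else 0) (β γ n : Fin 4) :
    ∑ α, structC P θ e β γ α * e α n
      = frameDer P e β (e γ n) - frameDer P e γ (e β n) := by
  set v : Fin 4 → A := fun n => frameDer P e β (e γ n) - frameDer P e γ (e β n) with hv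
  have : ∑ α, structC P θ e β γ α * e α n = ∑ k, (∑ α, e α n * θ α k) * v k := by
    simp only [structC_eq hdual, Fin.sum_univ_four, hv]
    ring
  rw [this]
  simp [hdual', hv]

/-- The second-order terms are symmetric because the coordinate derivations commute; what remains is
the bracket of the two frame vectors acting on g. -/
theorem commutes_structC (hP : ∀ m n g, P m (P n g) = P n (P m g))
    (hdual : ∀ α β, ∑ m, θ α m * e β m = if α = β then 1 else 0)
    (hdual' : ∀ m n, ∑ α, e α m * θ α n = if m = n then 1 else 0) :
    Commutes (frameDer P e) (structC P θ e) := by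
  intro α β g
  have h1 : ∀ α β, frameDer P e α (frameDer P e β g)
      = ∑ n, frameDer P e α (e β n) * P n g + ∑ n, ∑ m, e β n * e α m * P m (P n g) := by
    intro α β
    rw [frameDer_apply P e β, map_sum]
    simp only [Derivation.leibniz, smul_eq_mul, Finset.sum_add_distrib]
    rw [add_comm]
    congr 1
    · simp only [mul_comm]
    · simp only [frameDer_apply, Finset.mul_sum, mul_assoc]
  have h2 : ∑ n, ∑ m, e β n * e α m * P m (P n g) = ∑ n, ∑ m, e α n * e β m * P m (P n g) := by
    rw [Finset.sum_comm]
    refine Finset.sum_congr rfl fun m _ => Finset.sum_congr rfl fun n _ => ?_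
    rw [hP m n]; ring
  have h3 : ∑ γ, structC P θ e α β γ * frameDer P e γ g
      = ∑ n, (∑ γ, structC P θ e α β γ * e γ n) * P n g := by
    simp only [frameDer_apply, Fin.sum_univ_four]; ring
  rw [h1, h1, h2, h3]
  simp only [structC_frame hdual hdual', sub_mul, Finset.sum_sub_distrib]
  ring

/-- This is the Jacobi identity for brackets of vector fields. It is checked on coordinate
components, by contracting the cyclic sum `J` with the frame, and the coframe then removes the
frame. -/
theorem jacobi_structC (hP : ∀ m n g, P m (P n g) = P n (P m g))
    (hdual : ∀ α β, ∑ m, θ α m * e β m = if α = β then 1 else 0)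
    (hdual' : ∀ m n, ∑ α, e α m * θ α n = if m = n then 1 else 0) :
    Jacobi (frameDer P e) (structC P θ e) := by
  intro α β γ δ
  have hc := commutes_structC hP hdual hdual'
  set D := frameDer P e with hD
  set c := structC P θ e with hcdef
  have hF : ∀ β γ n, ∑ σ, c β γ σ * e σ n = D β (e γ n) - D γ (e β n) :=
    structC_frame hdual hdual'
  have hDF : ∀ α β γ n, ∑ σ, (D α (c β γ σ) * e σ n + c β γ σ * D α (e σ n))
      = D α (D β (e γ n)) - D α (D γ (e β n)) := by
    intro α β γ n
    rw [← map_sub, ← hF, map_sum]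
    simp only [Derivation.leibniz, smul_eq_mul]
    refine Finset.sum_congr rfl fun σ _ => by ring
  set J : Fin 4 → A := fun δ => (D α (c β γ δ) + ∑ r, c β γ r * c α r δ)
    + (D β (c γ α δ) + ∑ r, c γ α r * c β r δ)
    + (D γ (c α β δ) + ∑ r, c α β r * c γ r δ) with hJ
  have hq : ∀ α β γ n, ∑ σ, (∑ r, c β γ r * c α r σ) * e σ n
      = ∑ r, c β γ r * (D α (e r n) - D r (e α n)) := by
    intro α β γ n
    simp only [← hF, Fin.sum_univ_four]
    ring
  -- The derivatives of the brackets (`hDF`) leave commutators acting on frame components; these are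
  -- first order by `hc`, and cancel against the quadratic terms `hq` in the cyclic sum.
  have hJe : ∀ n, ∑ σ, J σ * e σ n = 0 := by
    intro n
    have e1 := hDF α β γ n
    have e2 := hDF β γ α n
    have e3 := hDF γ α β n
    have q1 := hq α β γ n
    have q2 := hq β γ α n
    have q3 := hq γ α β n
    have c1 := hc α β (e γ n)
    have c2 := hc β γ (e α n)
    have c3 := hc γ α (e β n)
    simp only [hJ, add_mul, Finset.sum_add_distrib, mul_sub, Finset.sum_sub_distrib] at *
    linear_combination e1 + e2 + e3 + q1 + q2 + q3 + c1 + c2 + c3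
  have : J δ = ∑ n, θ δ n * ∑ σ, J σ * e σ n := by
    have : ∑ n, θ δ n * ∑ σ, J σ * e σ n = ∑ σ, J σ * ∑ n, θ δ n * e σ n := by
      simp only [Fin.sum_univ_four]; ring
    rw [this]
    simp [hdual]
  change J δ = 0
  rw [this]
  simp [hJe]

/-! ### Curvature of a metric, torsion free connection -/

/-- `eps` with values in an `ℝ`-algebra. -/
def epsA (A : Type*) [CommRing A] [Algebra ℝ A] (α : Fin 4) : A := algebraMap ℝ A (eps α)

theorem epsA_mul_self (α : Fin 4) : epsA A α * epsA A α = 1 := by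
  rw [epsA, ← map_mul, eps_mul_self, map_one]

theorem der_epsA_mul (D : Derivation ℝ A A) (α : Fin 4) (g : A) :
    D (epsA A α * g) = epsA A α * D g := by
  simp [epsA, Derivation.leibniz]

/-- The mixed curvature `R_{λμ}{}^α{}_β` of the connection `w`. -/
def curvUp (D : Fin 4 → Derivation ℝ A A) (w : Fin 4 → Fin 4 → Fin 4 → A) (l μ α β : Fin 4) : A :=
  D l (w μ β α) - D μ (w l β α)
    + ∑ r, (-(w r β α * (w l μ r - w μ l r)) + w l r α * w μ β r - w μ r α * w l β r)

/-- The lowered curvature `R_{λμ,αβ}`. -/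
def curvDown (D : Fin 4 → Derivation ℝ A A) (w : Fin 4 → Fin 4 → Fin 4 → A) (l μ α β : Fin 4) : A :=
  epsA A α * curvUp D w l μ α β

/-- The covariant derivative `∇_α R_{βγ,λμ}` of an array with four lower indices. -/
def nabla4 (D : Fin 4 → Derivation ℝ A A) (w : Fin 4 → Fin 4 → Fin 4 → A)
    (R : Fin 4 → Fin 4 → Fin 4 → Fin 4 → A) (α β γ l μ : Fin 4) : A :=
  D α (R β γ l μ) - ∑ s, (w α β s * R s γ l μ + w α γ s * R β s l μ
    + w α l s * R β γ s μ + w α μ s * R β γ l s)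

/-- The covariant derivative `∇_α T_{βγ}` of an array with two lower indices. -/
def nabla2 (D : Fin 4 → Derivation ℝ A A) (w : Fin 4 → Fin 4 → Fin 4 → A)
    (T : Fin 4 → Fin 4 → A) (α β γ : Fin 4) : A :=
  D α (T β γ) - ∑ s, (w α β s * T s γ + w α γ s * T β s)

variable {D : Fin 4 → Derivation ℝ A A} {c w : Fin 4 → Fin 4 → Fin 4 → A}

theorem curvUp_antisymm (l μ α β : Fin 4) : curvUp D w l μ α β = -curvUp D w μ l α β := by
  simp only [curvUp, Fin.sum_univ_four]; ring

theorem curvDown_antisymm (l μ α β : Fin 4) :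
    curvDown D w l μ α β = -curvDown D w μ l α β := by
  rw [curvDown, curvUp_antisymm, curvDown]; ring

/-- The lowered connection is antisymmetric in its last two indices. The signs are constant, so its
derivatives are too, and in the products the condition applied to both factors exchanges the two
quadratic terms. -/
theorem curvDown_antisymm_right
    (hmet : ∀ γ β l, epsA A l * w γ β l + epsA A β * w γ l β = 0) (l μ α β : Fin 4) :
    curvDown D w l μ α β = -curvDown D w l μ β α := by
  have hD : ∀ δ γ β l, epsA A l * D δ (w γ β l) + epsA A β * D δ (w γ l β) = 0 := by
    intro δ γ β l
    have := congrArg (D δ) (hmet γ β l)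
    simpa only [map_add, der_epsA_mul, map_zero] using this
  have hq : ∀ l μ r, epsA A α * (w l r α * w μ β r) = epsA A β * (w μ r β * w l α r) := by
    intro l μ r
    linear_combination w μ β r * hmet l r α - w l α r * hmet μ β r
  have hs : ∀ r, epsA A α * (-(w r β α * (w l μ r - w μ l r)) + w l r α * w μ β r
        - w μ r α * w l β r)
      = -(epsA A β * (-(w r α β * (w l μ r - w μ l r)) + w l r β * w μ α r
        - w μ r β * w l α r)) := by
    intro r
    linear_combination hq l μ r - hq μ l r - (w l μ r - w μ l r) * hmet r β α
  simp only [curvDown, curvUp]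
  rw [mul_add, mul_add, Finset.mul_sum, Finset.sum_congr rfl fun r _ => hs r,
    Finset.sum_neg_distrib, ← Finset.mul_sum]
  linear_combination hD l μ β α - hD μ l β α

/-- With c replaced by the antisymmetrised connection, the Jacobi identity is exactly this cyclic
sum. -/
theorem curvUp_bianchi (hjac : Jacobi D c) (htor : ∀ α β γ, w α β γ - w β α γ = c α β γ)
    (l μ β α : Fin 4) :
    curvUp D w l μ α β + curvUp D w μ β α l + curvUp D w β l α μ = 0 := by
  have h := hjac l μ β α
  simp only [← htor, map_sub] at h
  simp only [curvUp, Fin.sum_univ_four] at *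
  linear_combination h

/-- The classical combination of four cyclic sums: the antisymmetries cancel all terms except twice
the desired difference. -/
theorem curvDown_pair (hjac : Jacobi D c) (htor : ∀ α β γ, w α β γ - w β α γ = c α β γ)
    (hmet : ∀ γ β l, epsA A l * w γ β l + epsA A β * w γ l β = 0) (l μ α β : Fin 4) :
    curvDown D w l μ α β = curvDown D w α β l μ := by
  have b : ∀ l μ β α, curvDown D w l μ α β + curvDown D w μ β α l + curvDown D w β l α μ = 0 := by
    intro l μ β α
    rw [curvDown, curvDown, curvDown, ← mul_add, ← mul_add, curvUp_bianchi hjac htor, mul_zero]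
  have s1 := @curvDown_antisymm A _ _ D w
  have s2 := @curvDown_antisymm_right A _ _ D w hmet
  have two : (2 : A) * (curvDown D w l μ α β - curvDown D w α β l μ) = 0 := by
    have b1 := b l μ β α
    have b2 := b l μ α β
    have b3 := b α β μ l
    have b4 := b α β l μ
    rw [s2 l μ β α, s1 μ α β l, s2 α l β μ] at b2
    rw [s1 β μ l α, s2 μ β l α, s1 μ α l β, s2 α μ l β] at b3
    rw [s2 α β μ l, s2 β l μ α, s1 l α μ β] at b4
    linear_combination b1 - b2 - b3 + b4
  -- The algebra is arbitrary, so 2 is cancelled as the image of an invertible real number.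
  have h2 : IsUnit (2 : A) := by
    have : IsUnit (algebraMap ℝ A 2) := (isUnit_iff_ne_zero.mpr two_ne_zero).map _
    simpa only [map_ofNat] using this
  exact sub_eq_zero.mp ((h2.mul_right_eq_zero).mp two)

/-- Second derivatives of the connection occur only in commutators, which `hc` makes first order;
derivatives of c occur only in the cyclic sums controlled by the Jacobi identity. The indices of the
differentiated 2-form are not yet covariantised, hence the terms in c on the right. -/
theorem curvUp_second_bianchi (hc : Commutes D c) (hjac : Jacobi D c)
    (htor : ∀ α β γ, w α β γ - w β α γ = c α β γ) (α β γ δ ε : Fin 4) :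
    (D α (curvUp D w β γ δ ε)
        + ∑ s, (w α s δ * curvUp D w β γ s ε - w α ε s * curvUp D w β γ δ s))
      + (D β (curvUp D w γ α δ ε)
        + ∑ s, (w β s δ * curvUp D w γ α s ε - w β ε s * curvUp D w γ α δ s))
      + (D γ (curvUp D w α β δ ε)
        + ∑ s, (w γ s δ * curvUp D w α β s ε - w γ ε s * curvUp D w α β δ s))
      = ∑ s, (c α β s * curvUp D w s γ δ ε + c β γ s * curvUp D w s α δ ε
        + c γ α s * curvUp D w s β δ ε) := by
  have ha : ∀ α r σ, c α r σ = -c r α σ := by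
    intro α r σ; rw [← htor, ← htor]; ring
  have j : ∀ σ, D α (c β γ σ) + D β (c γ α σ) + D γ (c α β σ)
      = ∑ r, (c β γ r * c r α σ + c γ α r * c r β σ + c α β r * c r γ σ) := by
    intro σ
    have hs : ∀ r, c β γ r * c r α σ + c γ α r * c r β σ + c α β r * c r γ σ
        = -(c β γ r * c α r σ + c γ α r * c β r σ + c α β r * c γ r σ) := by
      intro r; rw [ha r α, ha r β, ha r γ]; ring
    rw [Finset.sum_congr rfl fun r _ => hs r, Finset.sum_neg_distrib, Finset.sum_add_distrib,
      Finset.sum_add_distrib]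
    linear_combination hjac α β γ σ
  have c1 := hc α β (w γ ε δ)
  have c2 := hc β γ (w α ε δ)
  have c3 := hc γ α (w β ε δ)
  simp only [curvUp, htor, map_add, map_sub, map_neg, Derivation.leibniz, smul_eq_mul,
    Fin.sum_univ_four] at c1 c2 c3 j ⊢
  linear_combination (exp := 1) c1 + c2 + c3 - w 0 ε δ * j 0 - w 1 ε δ * j 1 - w 2 ε δ * j 2
    - w 3 ε δ * j 3

/-- Metricity lets the index l be lowered under ∇. The connection terms on the first pair are kept
apart, since in the cyclic sum they combine to the torsion terms of `curvUp_second_bianchi`. -/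
theorem nabla4_curvDown (hmet : ∀ γ β l, epsA A l * w γ β l + epsA A β * w γ l β = 0)
    (α β γ l μ : Fin 4) :
    nabla4 D w (curvDown D w) α β γ l μ
      = epsA A l * ((D α (curvUp D w β γ l μ)
          + ∑ s, (w α s l * curvUp D w β γ s μ - w α μ s * curvUp D w β γ l s))
        - ∑ s, (w α β s * curvUp D w s γ l μ - w α γ s * curvUp D w s β l μ)) := by
  have h : ∀ s, w α β s * curvDown D w s γ l μ + w α γ s * curvDown D w β s l μ
      + w α l s * curvDown D w β γ s μ + w α μ s * curvDown D w β γ l s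
      = epsA A l * (-(w α s l * curvUp D w β γ s μ - w α μ s * curvUp D w β γ l s)
        + (w α β s * curvUp D w s γ l μ - w α γ s * curvUp D w s β l μ)) := by
    intro s
    rw [curvDown_antisymm β s]
    simp only [curvDown]
    linear_combination curvUp D w β γ s μ * hmet α l s
  rw [nabla4, Finset.sum_congr rfl fun s _ => h s, ← Finset.mul_sum, Finset.sum_add_distrib,
    Finset.sum_neg_distrib, curvDown, der_epsA_mul]
  ring

/-- The second Bianchi identity. -/
theorem nabla4_second_bianchi (hc : Commutes D c) (hjac : Jacobi D c)
    (htor : ∀ α β γ, w α β γ - w β α γ = c α β γ)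
    (hmet : ∀ γ β l, epsA A l * w γ β l + epsA A β * w γ l β = 0) (α β γ l μ : Fin 4) :
    nabla4 D w (curvDown D w) α β γ l μ + nabla4 D w (curvDown D w) β γ α l μ
      + nabla4 D w (curvDown D w) γ α β l μ = 0 := by
  have h := curvUp_second_bianchi hc hjac htor α β γ l μ
  simp only [← htor] at h
  simp only [nabla4_curvDown hmet, ← mul_add]
  refine mul_eq_zero_of_right _ ?_
  simp only [sub_mul, Finset.sum_add_distrib, Finset.sum_sub_distrib] at h ⊢
  linear_combination h

theorem nabla4_antisymm {R : Fin 4 → Fin 4 → Fin 4 → Fin 4 → A}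
    (hR : ∀ β γ l μ, R β γ l μ = -R γ β l μ) (α β γ l μ : Fin 4) :
    nabla4 D w R α β γ l μ = -nabla4 D w R α γ β l μ := by
  have h : ∀ s, w α β s * R s γ l μ + w α γ s * R β s l μ + w α l s * R β γ s μ
      + w α μ s * R β γ l s = -(w α γ s * R s β l μ + w α β s * R γ s l μ + w α l s * R γ β s μ
      + w α μ s * R γ β l s) := by
    intro s
    rw [hR s γ, hR s β, hR β γ s, hR β γ l s]; ring
  rw [nabla4, nabla4, Finset.sum_congr rfl fun s _ => h s, hR, map_neg, Finset.sum_neg_distrib]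
  ring

theorem nabla4_pair {R : Fin 4 → Fin 4 → Fin 4 → Fin 4 → A}
    (hR : ∀ β γ l μ, R β γ l μ = R l μ β γ) (α β γ l μ : Fin 4) :
    nabla4 D w R α β γ l μ = nabla4 D w R α l μ β γ := by
  rw [nabla4, nabla4, hR β γ l μ]
  congr 1
  refine Finset.sum_congr rfl fun s _ => ?_
  rw [hR s γ, hR β s, hR β γ s, hR β γ l s]; ring

/-- The Ricci array `R_{μβ} = R_{αμ}{}^α{}_β`. -/
def ricciA (D : Fin 4 → Derivation ℝ A A) (w : Fin 4 → Fin 4 → Fin 4 → A) (μ β : Fin 4) : A :=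
  ∑ α, curvUp D w α μ α β

theorem ricciA_eq (μ β : Fin 4) : ricciA D w μ β = ∑ α, epsA A α * curvDown D w α μ α β := by
  refine Finset.sum_congr rfl fun α _ => ?_
  rw [curvDown, ← mul_assoc, epsA_mul_self, one_mul]

/-- Contraction commutes with ∇ for a metric connection: the terms acting on the contracted indices
cancel. -/
theorem sum_nabla4_eq_nabla2_ricci
    (hmet : ∀ γ β l, epsA A l * w γ β l + epsA A β * w γ l β = 0) (l μ i : Fin 4) :
    ∑ α, epsA A α * nabla4 D w (curvDown D w) l α μ α i = nabla2 D w (ricciA D w) l μ i := by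
  -- Metricity makes ε_α ω_{lα}^s antisymmetric in α and s, and it is summed against a symmetric
  -- expression.
  have hz : ∀ T : Fin 4 → Fin 4 → A,
      ∑ α, ∑ s, epsA A α * (w l α s * T s α + w l α s * T α s) = 0 := by
    intro T
    have h1 : ∑ α, ∑ s, epsA A α * (w l α s * T s α)
        = -∑ α, ∑ s, epsA A α * (w l α s * T α s) := by
      rw [Finset.sum_comm, ← Finset.sum_neg_distrib]
      refine Finset.sum_congr rfl fun s _ => ?_
      rw [← Finset.sum_neg_distrib]
      refine Finset.sum_congr rfl fun α _ => ?_
      have e1 := epsA_mul_self (A := A) α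
      have e2 := epsA_mul_self (A := A) s
      linear_combination epsA A α * epsA A s * T s α * hmet l α s
        - T s α * epsA A α * w l α s * e2 - T s α * epsA A s * w l s α * e1
    simp only [mul_add, Finset.sum_add_distrib]
    rw [h1]; ring
  have h := hz fun s α => curvDown D w s μ α i
  simp only [nabla4, nabla2, ricciA_eq, map_add, der_epsA_mul, Fin.sum_univ_four] at h ⊢
  linear_combination -h

/-- The contracted Bianchi identity `∇_α R^α{}_{i,λμ} = ∇_λ R_{μi} - ∇_μ R_{λi}`. -/
theorem contracted_bianchi (hc : Commutes D c) (hjac : Jacobi D c)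
    (htor : ∀ α β γ, w α β γ - w β α γ = c α β γ)
    (hmet : ∀ γ β l, epsA A l * w γ β l + epsA A β * w γ l β = 0) (l μ i : Fin 4) :
    ∑ α, epsA A α * nabla4 D w (curvDown D w) α α i l μ
      = nabla2 D w (ricciA D w) l μ i - nabla2 D w (ricciA D w) μ l i := by
  rw [← sum_nabla4_eq_nabla2_ricci hmet, ← sum_nabla4_eq_nabla2_ricci hmet,
    ← Finset.sum_sub_distrib]
  refine Finset.sum_congr rfl fun α _ => ?_
  have b := nabla4_second_bianchi hc hjac htor hmet α l μ α i
  -- Pair symmetry puts the summed index into the second pair; the Bianchi identity on the indices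
  -- α, l, μ then leaves two Ricci contractions.
  rw [nabla4_pair (curvDown_pair hjac htor hmet) α α i l μ]
  rw [nabla4_antisymm curvDown_antisymm l μ α] at b
  linear_combination epsA A α * b

end FrameCalculus

/-! ### Smooth functions on an open set of the coordinate space -/

/-- Extension by zero of a function defined on `Ω`. -/
noncomputable def extendZero {Ω : Set Pt} (g : Ω → ℝ) : Pt → ℝ := Function.extend Subtype.val g 0

theorem extendZero_apply {Ω : Set Pt} (g : Ω → ℝ) {x : Pt} (hx : x ∈ Ω) :
    extendZero g x = g ⟨x, hx⟩ :=
  Subtype.val_injective.extend_apply g 0 ⟨x, hx⟩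

/-- The algebra of smooth functions on `Ω`. -/
noncomputable def SmoothFun (Ω : Set Pt) : Subalgebra ℝ (Ω → ℝ) where
  carrier := {g | ContDiffOn ℝ ∞ (extendZero g) Ω}
  mul_mem' {f g} hf hg := (ContDiffOn.mul hf hg).congr fun x hx => by
    simp [extendZero_apply _ hx]
  add_mem' {f g} hf hg := (ContDiffOn.add hf hg).congr fun x hx => by
    simp [extendZero_apply _ hx]
  algebraMap_mem' r := (contDiffOn_const (c := r)).congr fun x hx => by
    simp [extendZero_apply _ hx]

variable {Ω : Set Pt}

/-- `F : SmoothFun Ω` is the restriction to `Ω` of the function `g`. -/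
def Represents (F : SmoothFun Ω) (g : Pt → ℝ) : Prop := ∀ y (hy : y ∈ Ω), F.1 ⟨y, hy⟩ = g y

/-- The restriction to `Ω` of a function which is smooth there. -/
noncomputable def restr (g : Pt → ℝ) (hg : ContDiffOn ℝ ∞ g Ω) : SmoothFun Ω :=
  ⟨fun y => g y, hg.congr fun _ hx => extendZero_apply _ hx⟩

theorem represents_restr (g : Pt → ℝ) (hg : ContDiffOn ℝ ∞ g Ω) : Represents (restr g hg) g :=
  fun _ _ => rfl

namespace Represents

variable {F G : SmoothFun Ω} {g h : Pt → ℝ}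

theorem contDiffOn (hF : Represents F g) : ContDiffOn ℝ ∞ g Ω :=
  ContDiffOn.congr F.2 fun x hx => by rw [extendZero_apply _ hx, hF x hx]

/-- An identity valid at all points of Ω becomes an identity in the algebra, to which derivations
may be applied. -/
theorem eq (hF : Represents F g) (hG : Represents G g) : F = G :=
  Subtype.ext <| funext fun ⟨y, hy⟩ => (hF y hy).trans (hG y hy).symm

theorem congr (hF : Represents F g) (hgh : ∀ y ∈ Ω, g y = h y) : Represents F h :=
  fun y hy => (hF y hy).trans (hgh y hy)

/-- The way back: an algebraic identity is read at a point of Ω. -/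
theorem eqOn (hF : Represents F g) (hG : Represents F h) {x : Pt} (hx : x ∈ Ω) : g x = h x :=
  (hF x hx).symm.trans (hG x hx)

theorem add (hF : Represents F g) (hG : Represents G h) :
    Represents (F + G) fun y => g y + h y :=
  fun y hy => congrArg₂ (· + ·) (hF y hy) (hG y hy)

theorem sub (hF : Represents F g) (hG : Represents G h) :
    Represents (F - G) fun y => g y - h y :=
  fun y hy => congrArg₂ (· - ·) (hF y hy) (hG y hy)

theorem mul (hF : Represents F g) (hG : Represents G h) :
    Represents (F * G) fun y => g y * h y :=
  fun y hy => congrArg₂ (· * ·) (hF y hy) (hG y hy)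

theorem neg (hF : Represents F g) : Represents (-F) fun y => -g y :=
  fun y hy => congrArg (-·) (hF y hy)

theorem const (r : ℝ) : Represents (algebraMap ℝ (SmoothFun Ω) r) fun _ => r := fun _ _ => rfl

theorem zero : Represents (0 : SmoothFun Ω) fun _ => 0 := fun _ _ => rfl

theorem one : Represents (1 : SmoothFun Ω) fun _ => 1 := fun _ _ => rfl

theorem sum {ι : Type*} [Fintype ι] {F : ι → SmoothFun Ω} {g : ι → Pt → ℝ}
    (hF : ∀ i, Represents (F i) (g i)) : Represents (∑ i, F i) fun y => ∑ i, g i y := by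
  intro y hy
  rw [AddSubmonoidClass.coe_finsetSum, Finset.sum_apply]
  exact Finset.sum_congr rfl fun i _ => hF i y hy

end Represents

/-- Ω is open, so a derivative at one of its points ignores values outside; this makes the extension
by zero harmless. -/
theorem pd_congr (hΩ : IsOpen Ω) {g h : Pt → ℝ} (hgh : ∀ y ∈ Ω, g y = h y) (m : Fin 4) {x : Pt}
    (hx : x ∈ Ω) : pd m g x = pd m h x := by
  have : g =ᶠ[nhds x] h := Filter.eventuallyEq_of_mem (hΩ.mem_nhds hx) hgh
  rw [pd, pd, this.fderiv_eq]

theorem contDiffOn_pd (hΩ : IsOpen Ω) {g : Pt → ℝ} (hg : ContDiffOn ℝ ∞ g Ω) (m : Fin 4) :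
    ContDiffOn ℝ ∞ (pd m g) Ω :=
  (hg.fderiv_of_isOpen hΩ (m := ∞) (by simp)).clm_apply contDiffOn_const

theorem differentiableAt_of_contDiffOn {E : Type*} [NormedAddCommGroup E] [NormedSpace ℝ E]
    {s : Set E} (hs : IsOpen s) {g : E → ℝ} (hg : ContDiffOn ℝ ∞ g s) {x : E} (hx : x ∈ s) :
    DifferentiableAt ℝ g x :=
  (hg.contDiffAt (hs.mem_nhds hx)).differentiableAt (by simp)

theorem pd_add {g h : Pt → ℝ} {x : Pt} (hg : DifferentiableAt ℝ g x)
    (hh : DifferentiableAt ℝ h x) (m : Fin 4) :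
    pd m (fun y => g y + h y) x = pd m g x + pd m h x := by
  simp [pd, fderiv_fun_add hg hh]

theorem pd_mul {g h : Pt → ℝ} {x : Pt} (hg : DifferentiableAt ℝ g x)
    (hh : DifferentiableAt ℝ h x) (m : Fin 4) :
    pd m (fun y => g y * h y) x = g x * pd m h x + h x * pd m g x := by
  simp [pd, fderiv_fun_mul hg hh]

theorem pd_const (r : ℝ) (m : Fin 4) (x : Pt) : pd m (fun _ => r) x = 0 := by
  simp [pd]

theorem pd_comm (hΩ : IsOpen Ω) {g : Pt → ℝ} (hg : ContDiffOn ℝ ∞ g Ω) (m n : Fin 4) {x : Pt}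
    (hx : x ∈ Ω) : pd m (pd n g) x = pd n (pd m g) x := by
  have hc : ContDiffAt ℝ ∞ g x := hg.contDiffAt (hΩ.mem_nhds hx)
  have hd : DifferentiableAt ℝ (fderiv ℝ g) x :=
    (hc.fderiv_right (m := ∞) (by simp)).differentiableAt (by simp)
  have key : ∀ m n, pd m (pd n g) x
      = fderiv ℝ (fderiv ℝ g) x (Pi.single m 1) (Pi.single n 1) := by
    intro m n
    have : pd n g = fun y => fderiv ℝ g y (Pi.single n 1) := rfl
    rw [this, pd, fderiv_clm_apply hd (differentiableAt_const _)]
    simp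
  rw [key, key]
  exact ((hc.of_le (m := ((2 : ℕ∞) : WithTop ℕ∞)) (WithTop.coe_le_coe.2 le_top)).isSymmSndFDerivAt (by simp)).eq _ _

/-- The derivation `∂/∂x^m` of the algebra of smooth functions. -/
noncomputable def pdDer (hΩ : IsOpen Ω) (m : Fin 4) :
    Derivation ℝ (SmoothFun Ω) (SmoothFun Ω) where
  toFun F := restr (pd m (extendZero F.1)) (contDiffOn_pd hΩ F.2 m)
  map_add' F G := Subtype.ext <| funext fun ⟨y, hy⟩ => by
    have hF := differentiableAt_of_contDiffOn hΩ F.2 hy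
    have hG := differentiableAt_of_contDiffOn hΩ G.2 hy
    refine Eq.trans ?_ (pd_add hF hG m)
    exact pd_congr hΩ (fun z hz => by simp [extendZero_apply _ hz]) m hy
  map_smul' r F := Subtype.ext <| funext fun ⟨y, hy⟩ => by
    have hF := differentiableAt_of_contDiffOn hΩ F.2 hy
    have h := pd_mul (differentiableAt_const r) hF m
    rw [pd_const, mul_zero, add_zero] at h
    refine Eq.trans ?_ h
    exact pd_congr hΩ (fun z hz => by simp [extendZero_apply _ hz]) m hy
  map_one_eq_zero' := Subtype.ext <| funext fun ⟨y, hy⟩ => by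
    refine Eq.trans ?_ (pd_const 1 m y)
    exact pd_congr hΩ (fun z hz => by simp [extendZero_apply _ hz]) m hy
  leibniz' F G := Subtype.ext <| funext fun ⟨y, hy⟩ => by
    have hF := differentiableAt_of_contDiffOn hΩ F.2 hy
    have hG := differentiableAt_of_contDiffOn hΩ G.2 hy
    have h := pd_mul hF hG m
    rw [extendZero_apply _ hy, extendZero_apply _ hy] at h
    refine Eq.trans ?_ h
    exact pd_congr hΩ (fun z hz => by simp [extendZero_apply _ hz]) m hy

theorem Represents.pdDer (hΩ : IsOpen Ω) {F : SmoothFun Ω} {g : Pt → ℝ} (hF : Represents F g)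
    (m : Fin 4) : Represents (pdDer hΩ m F) (pd m g) := fun y hy =>
  pd_congr hΩ (fun z hz => by rw [extendZero_apply _ hz, hF z hz]) m hy

theorem pdDer_comm (hΩ : IsOpen Ω) (m n : Fin 4) (F : SmoothFun Ω) :
    pdDer hΩ m (pdDer hΩ n F) = pdDer hΩ n (pdDer hΩ m F) := by
  have hF : Represents F (extendZero F.1) := fun y hy => (extendZero_apply _ hy).symm
  exact ((hF.pdDer hΩ n).pdDer hΩ m).eq
    (((hF.pdDer hΩ m).pdDer hΩ n).congr fun y hy => pd_comm hΩ F.2 n m hy)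

/-! ### Smoothness of frames -/

/-- Cramer's rule: the entries are cofactors, polynomial in a, divided by the nonvanishing
determinant. -/
theorem contDiffOn_matrix_inv {E : Type*} [NormedAddCommGroup E] [NormedSpace ℝ E] {s : Set E}
    {a : E → Fin 3 → Fin 3 → ℝ} (ha : ∀ i j, ContDiffOn ℝ ∞ (fun y => a y i j) s)
    (hdet : ∀ y ∈ s, (Matrix.of (a y)).det ≠ 0) (i j : Fin 3) :
    ContDiffOn ℝ ∞ (fun y => (Matrix.of (a y))⁻¹ i j) s := by
  have hd : ContDiffOn ℝ ∞ (fun y => (Matrix.of (a y)).det) s := by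
    simp only [Matrix.det_fin_three, Matrix.of_apply]
    have := ha
    fun_prop
  have hadj : ContDiffOn ℝ ∞ (fun y => (Matrix.of (a y)).adjugate i j) s := by
    have := ha
    fin_cases i <;> fin_cases j <;> simp [Matrix.adjugate_fin_three] <;> fun_prop
  refine ((hd.inv hdet).mul hadj).congr fun y _ => ?_
  simp [Matrix.inv_def]

theorem contDiffOn_frame {E : Type*} [NormedAddCommGroup E] [NormedSpace ℝ E] {s : Set E}
    {U : E → ℝ} {a : E → Fin 3 → Fin 3 → ℝ} {b : E → Fin 3 → ℝ} (hU : ContDiffOn ℝ ∞ U s)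
    (hU0 : ∀ y ∈ s, U y ≠ 0) (ha : ∀ i j, ContDiffOn ℝ ∞ (fun y => a y i j) s)
    (hdet : ∀ y ∈ s, (Matrix.of (a y)).det ≠ 0) (hb : ∀ i, ContDiffOn ℝ ∞ (fun y => b y i) s)
    (α m : Fin 4) : ContDiffOn ℝ ∞ (fun y => frame (U y) (a y) (b y) α m) s := by
  have hA := contDiffOn_matrix_inv ha hdet
  have hUi := hU.inv hU0
  induction α using Fin.cases with
  | zero =>
    induction m using Fin.cases with
    | zero => exact hUi
    | succ j => simpa [frame] using contDiffOn_const
  | succ i =>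
    induction m using Fin.cases with
    | zero =>
      simp only [frame, Fin.cons_succ, Fin.cons_zero]
      exact (hUi.mul (ContDiffOn.sum fun j _ => (hA j i).mul (hb j))).neg
    | succ j => simpa [frame] using hA j i

theorem contDiffOn_coframe {E : Type*} [NormedAddCommGroup E] [NormedSpace ℝ E] {s : Set E}
    {U : E → ℝ} {a : E → Fin 3 → Fin 3 → ℝ} {b : E → Fin 3 → ℝ} (hU : ContDiffOn ℝ ∞ U s)
    (ha : ∀ i j, ContDiffOn ℝ ∞ (fun y => a y i j) s) (hb : ∀ i, ContDiffOn ℝ ∞ (fun y => b y i) s)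
    (α m : Fin 4) : ContDiffOn ℝ ∞ (fun y => coframe (U y) (a y) (b y) α m) s := by
  induction α using Fin.cases with
  | zero =>
    induction m using Fin.cases with
    | zero => simpa [coframe] using hU
    | succ j => simpa [coframe] using hb j
  | succ i =>
    induction m using Fin.cases with
    | zero => simpa [coframe] using contDiffOn_const
    | succ j => simpa [coframe] using ha i j

/-- A one-sided inverse of a square matrix is two-sided. -/
theorem frame_coframe (U : ℝ) (a : Fin 3 → Fin 3 → ℝ) (b : Fin 3 → ℝ) (hU : U ≠ 0)
    (ha : (Matrix.of a).det ≠ 0) (m n : Fin 4) :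
    ∑ α, frame U a b α m * coframe U a b α n = if m = n then 1 else 0 := by
  have h : Matrix.of (coframe U a b) * (Matrix.of (frame U a b)).transpose = 1 := by
    ext α β
    simpa [Matrix.mul_apply, Matrix.one_apply] using coframe_frame U a b hU ha α β
  have h' := congrFun (congrFun (mul_eq_one_comm.mp h : _ = (1 : Matrix _ _ ℝ)) m) n
  simpa [Matrix.mul_apply, Matrix.one_apply] using h'

/-! ### The geometry of a smooth Cattaneo-Ferrarese frame -/

/-- A smooth nondegenerate Cattaneo-Ferrarese frame on an open set. -/
structure SmoothFrame (Ω : Set Pt) (U : Pt → ℝ) (a : Pt → Fin 3 → Fin 3 → ℝ) (b : Pt → Fin 3 → ℝ) :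
    Prop where
  isOpen : IsOpen Ω
  smooth_U : ContDiffOn ℝ ∞ U Ω
  smooth_a : ∀ i j, ContDiffOn ℝ ∞ (fun y => a y i j) Ω
  smooth_b : ∀ i, ContDiffOn ℝ ∞ (fun y => b y i) Ω
  lapse_ne_zero : ∀ x ∈ Ω, U x ≠ 0
  det_ne_zero : ∀ x ∈ Ω, (Matrix.of (a x)).det ≠ 0

theorem cfConn_metric (U : Pt → ℝ) (a : Pt → Fin 3 → Fin 3 → ℝ) (b : Pt → Fin 3 → ℝ) (x : Pt)
    (γ β l : Fin 4) : eps l * cfConn U a b x γ β l + eps β * cfConn U a b x γ l β = 0 :=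
  leviCivita_metric _ _ x γ β l

theorem cfConn_zero_zero (U : Pt → ℝ) (a : Pt → Fin 3 → Fin 3 → ℝ) (b : Pt → Fin 3 → ℝ) (x : Pt)
    (γ : Fin 4) : cfConn U a b x γ 0 0 = 0 := by
  have := cfConn_metric U a b x γ 0 0
  simp only [eps, if_true] at this
  linarith

/-- Lowering a time index changes the sign, so the antisymmetry of the lowered connection reads as a
symmetry here. -/
theorem cfConn_succ_zero (U : Pt → ℝ) (a : Pt → Fin 3 → Fin 3 → ℝ) (b : Pt → Fin 3 → ℝ) (x : Pt)
    (γ : Fin 4) (i : Fin 3) : cfConn U a b x γ i.succ 0 = cfConn U a b x γ 0 i.succ := by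
  have := cfConn_metric U a b x γ i.succ 0
  simp only [eps, if_true, Fin.succ_ne_zero, if_false] at this
  linarith

theorem cfConn_succ_succ (U : Pt → ℝ) (a : Pt → Fin 3 → Fin 3 → ℝ) (b : Pt → Fin 3 → ℝ) (x : Pt)
    (γ : Fin 4) (i j : Fin 3) :
    cfConn U a b x γ i.succ j.succ = -cfConn U a b x γ j.succ i.succ := by
  have := cfConn_metric U a b x γ i.succ j.succ
  simp only [eps, Fin.succ_ne_zero, if_false] at this
  linarith

theorem cfConn_torsion (U : Pt → ℝ) (a : Pt → Fin 3 → Fin 3 → ℝ) (b : Pt → Fin 3 → ℝ) (x : Pt)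
    (α β γ : Fin 4) : cfConn U a b x α β γ - cfConn U a b x β α γ
      = structCoeff (fun y => coframe (U y) (a y) (b y)) (fun y => frame (U y) (a y) (b y)) x α β γ :=
  leviCivita_torsion _ _ x α β γ

namespace SmoothFrame

variable {Ω : Set Pt} {U : Pt → ℝ} {a : Pt → Fin 3 → Fin 3 → ℝ} {b : Pt → Fin 3 → ℝ}
  (h : SmoothFrame Ω U a b)

/-- The coframe components as smooth functions on `Ω`. -/
noncomputable def coframeFun (α m : Fin 4) : SmoothFun Ω :=
  restr (fun y => coframe (U y) (a y) (b y) α m)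
    (contDiffOn_coframe h.smooth_U h.smooth_a h.smooth_b α m)

/-- The frame components as smooth functions on `Ω`. -/
noncomputable def frameFun (α m : Fin 4) : SmoothFun Ω :=
  restr (fun y => frame (U y) (a y) (b y) α m)
    (contDiffOn_frame h.smooth_U h.lapse_ne_zero h.smooth_a h.det_ne_zero h.smooth_b α m)

/-- The Pfaff derivatives as derivations of the algebra of smooth functions. -/
noncomputable def der : Fin 4 → Derivation ℝ (SmoothFun Ω) (SmoothFun Ω) :=
  frameDer (pdDer h.isOpen) h.frameFun

/-- The structure coefficients as smooth functions on `Ω`. -/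
noncomputable def structFun : Fin 4 → Fin 4 → Fin 4 → SmoothFun Ω :=
  structC (pdDer h.isOpen) h.coframeFun h.frameFun

theorem coframeFun_frameFun (α β : Fin 4) :
    ∑ m, h.coframeFun α m * h.frameFun β m = if α = β then 1 else 0 := by
  have h1 : Represents (∑ m, h.coframeFun α m * h.frameFun β m) _ :=
    .sum fun m => (represents_restr _ _).mul (represents_restr _ _)
  have h2 : Represents (if α = β then 1 else 0 : SmoothFun Ω) fun _ => if α = β then 1 else 0 := by
    split_ifs
    exacts [.one, .zero]
  exact (h1.congr fun y hy => coframe_frame _ _ _ (h.lapse_ne_zero y hy) (h.det_ne_zero y hy) α β).eq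
    h2

theorem frameFun_coframeFun (m n : Fin 4) :
    ∑ α, h.frameFun α m * h.coframeFun α n = if m = n then 1 else 0 := by
  have h1 : Represents (∑ α, h.frameFun α m * h.coframeFun α n) _ :=
    .sum fun α => (represents_restr _ _).mul (represents_restr _ _)
  have h2 : Represents (if m = n then 1 else 0 : SmoothFun Ω) fun _ => if m = n then 1 else 0 := by
    split_ifs
    exacts [.one, .zero]
  exact (h1.congr fun y hy => frame_coframe _ _ _ (h.lapse_ne_zero y hy) (h.det_ne_zero y hy) m n).eq
    h2

theorem commutes : Commutes h.der h.structFun :=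
  commutes_structC (pdDer_comm h.isOpen) h.coframeFun_frameFun h.frameFun_coframeFun

theorem jacobi : Jacobi h.der h.structFun :=
  jacobi_structC (pdDer_comm h.isOpen) h.coframeFun_frameFun h.frameFun_coframeFun

theorem represents_der {F : SmoothFun Ω} {g : Pt → ℝ} (hF : Represents F g) (α : Fin 4) :
    Represents (h.der α F) fun x => pfaff (frame (U x) (a x) (b x)) α g x := by
  rw [der, frameDer_apply]
  exact .sum fun m => (represents_restr _ _).mul (hF.pdDer h.isOpen m)

theorem represents_structFun (β γ α : Fin 4) : Represents (h.structFun β γ α) fun x =>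
    structCoeff (fun y => coframe (U y) (a y) (b y)) (fun y => frame (U y) (a y) (b y)) x β γ α :=
  .neg <| .sum fun _ => .sum fun _ =>
    ((((represents_restr _ _).pdDer h.isOpen _).sub ((represents_restr _ _).pdDer h.isOpen _)).mul
      (represents_restr _ _)).mul (represents_restr _ _)

theorem contDiffOn_cfConn (h : SmoothFrame Ω U a b) (α l μ : Fin 4) :
    ContDiffOn ℝ ∞ (fun x => cfConn U a b x α l μ) Ω := by
  have hc := fun α β γ => (h.represents_structFun α β γ).contDiffOn
  simp only [cfConn, leviCivita]
  fun_prop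

/-- The connection coefficients as smooth functions on `Ω`. -/
noncomputable def connFun (α l μ : Fin 4) : SmoothFun Ω := restr _ (h.contDiffOn_cfConn α l μ)

theorem represents_connFun (α l μ : Fin 4) :
    Represents (h.connFun α l μ) fun x => cfConn U a b x α l μ := represents_restr _ _

theorem connFun_torsion (α β γ : Fin 4) :
    h.connFun α β γ - h.connFun β α γ = h.structFun α β γ :=
  (((h.represents_connFun _ _ _).sub (h.represents_connFun _ _ _)).congr fun y _ =>
    cfConn_torsion U a b y α β γ).eq (h.represents_structFun α β γ)

theorem represents_epsA (α : Fin 4) : Represents (epsA (SmoothFun Ω) α) fun _ => eps α :=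
  .const _

theorem connFun_metric (γ β l : Fin 4) :
    epsA _ l * h.connFun γ β l + epsA _ β * h.connFun γ l β = 0 :=
  ((((represents_epsA l).mul (h.represents_connFun γ β l)).add
    ((represents_epsA β).mul (h.represents_connFun γ l β))).congr fun y _ =>
      cfConn_metric U a b y γ β l).eq .zero

theorem represents_curvUp (l μ α β : Fin 4) : Represents (curvUp h.der h.connFun l μ α β) fun x =>
    riemannUp (fun y => frame (U y) (a y) (b y)) (cfConn U a b) x l μ α β :=
  have hw := h.represents_connFun
  ((h.represents_der (hw _ _ _) _).sub (h.represents_der (hw _ _ _) _)).add <| .sum fun _ =>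
    ((((hw _ _ _).mul ((hw _ _ _).sub (hw _ _ _))).neg).add ((hw _ _ _).mul (hw _ _ _))).sub
      ((hw _ _ _).mul (hw _ _ _))

theorem represents_curvDown (l μ α β : Fin 4) :
    Represents (curvDown h.der h.connFun l μ α β) fun x =>
      riemannDown (fun y => frame (U y) (a y) (b y)) (cfConn U a b) x l μ α β :=
  (represents_epsA α).mul (h.represents_curvUp l μ α β)

theorem represents_ricciA (μ β : Fin 4) : Represents (ricciA h.der h.connFun μ β) fun x =>
    ricci (fun y => frame (U y) (a y) (b y)) (cfConn U a b) x μ β :=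
  .sum fun _ => h.represents_curvUp _ _ _ _

theorem pfaff_commutator (h : SmoothFrame Ω U a b) {g : Pt → ℝ} (hg : ContDiffOn ℝ ∞ g Ω) (α β : Fin 4) {x : Pt}
    (hx : x ∈ Ω) :
    pfaff (frame (U x) (a x) (b x)) α
        (fun y => pfaff (frame (U y) (a y) (b y)) β g y) x
      - pfaff (frame (U x) (a x) (b x)) β
        (fun y => pfaff (frame (U y) (a y) (b y)) α g y) x
      = ∑ γ, (cfConn U a b x α β γ - cfConn U a b x β α γ)
        * pfaff (frame (U x) (a x) (b x)) γ g x := by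
  have hr := represents_restr g hg
  have h1 := (h.represents_der (h.represents_der hr β) α).sub
    (h.represents_der (h.represents_der hr α) β)
  rw [h.commutes] at h1
  have h2 : Represents (∑ γ, h.structFun α β γ * h.der γ (restr g hg)) _ :=
    .sum fun γ => (h.represents_structFun α β γ).mul (h.represents_der hr γ)
  rw [h1.eqOn h2 hx]
  simp only [cfConn_torsion]

theorem riemannDown_antisymm (h : SmoothFrame Ω U a b) {x : Pt} (hx : x ∈ Ω) (l μ α β : Fin 4) :
    riemannDown (fun y => frame (U y) (a y) (b y)) (cfConn U a b) x l μ α β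
      = -riemannDown (fun y => frame (U y) (a y) (b y)) (cfConn U a b) x μ l α β := by
  have h1 := h.represents_curvDown l μ α β
  rw [curvDown_antisymm] at h1
  exact h1.eqOn (h.represents_curvDown μ l α β).neg hx

theorem riemannDown_antisymm_right (h : SmoothFrame Ω U a b) {x : Pt} (hx : x ∈ Ω) (l μ α β : Fin 4) :
    riemannDown (fun y => frame (U y) (a y) (b y)) (cfConn U a b) x l μ α β
      = -riemannDown (fun y => frame (U y) (a y) (b y)) (cfConn U a b) x l μ β α := by
  have h1 := h.represents_curvDown l μ α β
  rw [curvDown_antisymm_right h.connFun_metric] at h1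
  exact h1.eqOn (h.represents_curvDown l μ β α).neg hx

end SmoothFrame

/-- A state stores only components on pairs of indices. Any array with both antisymmetries is
recovered from them, which applies to the Riemann tensor and equally to its Pfaff derivatives. -/
theorem State.riem_eq {z : State} {t : Fin 4 → Fin 4 → Fin 4 → Fin 4 → ℝ}
    (hz : ∀ P Q, z (.R P Q) = t P.fst P.snd Q.fst Q.snd)
    (h1 : ∀ α β l μ, t α β l μ = -t β α l μ) (h2 : ∀ α β l μ, t α β l μ = -t α β μ l)
    (α β l μ : Fin 4) : z.riem α β l μ = t α β l μ := by
  have e : ∀ P, ofPairs (fun Q => z (.R P Q)) l μ = t P.fst P.snd l μ := by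
    intro P
    simp only [hz]
    rw [ofPairs_eq (fun l μ => t P.fst P.snd l μ) fun l μ => h2 _ _ l μ]
  rw [State.riem]
  simp only [e]
  rw [ofPairs_eq (fun α β => t α β l μ) fun α β => h1 α β l μ]

/-! ### Tensors of a state compared with those of the spacetime -/

namespace SmoothFrame

variable {Ω : Set Pt} {U : Pt → ℝ} {a : Pt → Fin 3 → Fin 3 → ℝ} {b : Pt → Fin 3 → ℝ}
  (h : SmoothFrame Ω U a b) (E : EquationOfState) (p S : Pt → ℝ)

theorem riem_unknowns (h : SmoothFrame Ω U a b) {x : Pt} (hx : x ∈ Ω) (α β l μ : Fin 4) :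
    (unknowns E U a b p S x).riem α β l μ
      = riemannDown (fun y => frame (U y) (a y) (b y)) (cfConn U a b) x α β l μ :=
  State.riem_eq (t := riemannDown (fun y => frame (U y) (a y) (b y)) (cfConn U a b) x)
    (fun _ _ => rfl) (h.riemannDown_antisymm hx) (h.riemannDown_antisymm_right hx) α β l μ

theorem riem_pfaffState (h : SmoothFrame Ω U a b) {x : Pt} (hx : x ∈ Ω) (γ α β l μ : Fin 4) :
    State.riem (pfaffState U (unknowns E U a b p S) x γ) α β l μ
      = pfaff (frame (U x) (a x) (b x)) γ (fun y => riemannDown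
        (fun y => frame (U y) (a y) (b y)) (cfConn U a b) y α β l μ) x := by
  refine State.riem_eq (t := fun α β l μ => pfaff (frame (U x) (a x) (b x)) γ (fun y => riemannDown
        (fun y => frame (U y) (a y) (b y)) (cfConn U a b) y α β l μ) x)
    (fun _ _ => rfl) (fun α β l μ => ?_) (fun α β l μ => ?_) α β l μ
  · have h1 := h.represents_der (h.represents_curvDown α β l μ) γ
    rw [curvDown_antisymm, map_neg] at h1
    exact h1.eqOn (h.represents_der (h.represents_curvDown β α l μ) γ).neg hx
  · have h1 := h.represents_der (h.represents_curvDown α β l μ) γ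
    rw [curvDown_antisymm_right h.connFun_metric, map_neg] at h1
    exact h1.eqOn (h.represents_der (h.represents_curvDown α β μ l) γ).neg hx

theorem conn_unknowns {x : Pt} {f : Fin 3 → Fin 3 → ℝ}
    (hf : ∀ i j : Fin 3, cfConn U a b x 0 i.succ j.succ = f i j) (α β γ : Fin 4) :
    (unknowns E U a b p S x).conn f α β γ = cfConn U a b x α β γ := by
  induction α using Fin.cases <;> induction β using Fin.cases <;> induction γ using Fin.cases <;>
    simp [State.conn, unknowns, cfConn_zero_zero, cfConn_succ_zero, hf]

/-- This connects the formal ∇R of the system with the algebraic one, for which the Bianchi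
identities are available. -/
theorem nablaRiem_unknowns {f : Pt → Fin 3 → Fin 3 → ℝ} {x : Pt} (hx : x ∈ Ω)
    (hf : ∀ i j : Fin 3, cfConn U a b x 0 i.succ j.succ = f x i j) (α β γ l μ : Fin 4) :
    (unknowns E U a b p S x).nablaRiem (f x) (pfaffState U (unknowns E U a b p S) x) α β γ l μ
      = (nabla4 h.der h.connFun (curvDown h.der h.connFun) α β γ l μ).1 ⟨x, hx⟩ := by
  have hR := h.represents_curvDown
  have hw := h.represents_connFun
  have h1 : Represents (nabla4 h.der h.connFun (curvDown h.der h.connFun) α β γ l μ) _ :=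
    (h.represents_der (hR _ _ _ _) _).sub <| .sum fun s =>
      ((((hw α β s).mul (hR s γ l μ)).add ((hw α γ s).mul (hR β s l μ))).add
        ((hw α l s).mul (hR β γ s μ))).add ((hw α μ s).mul (hR β γ l s))
  rw [h1 x hx, State.nablaRiem, h.riem_pfaffState E p S hx]
  simp only [h.riem_unknowns E p S hx, conn_unknowns E p S hf]

end SmoothFrame

/-! ### Equations of state -/

theorem deriv_fst_eq_fderiv {F : ℝ → ℝ → ℝ} {p s : ℝ}
    (hF : DifferentiableAt ℝ (fun q : ℝ × ℝ => F q.1 q.2) (p, s)) :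
    deriv (fun p' => F p' s) p = fderiv ℝ (fun q : ℝ × ℝ => F q.1 q.2) (p, s) (1, 0) := by
  have h : HasDerivAt (fun p' : ℝ => (p', s)) ((1 : ℝ), (0 : ℝ)) p :=
    (hasDerivAt_id p).prodMk (hasDerivAt_const p s)
  exact (hF.hasFDerivAt.comp_hasDerivAt p h).deriv

theorem deriv_snd_eq_fderiv {F : ℝ → ℝ → ℝ} {p s : ℝ}
    (hF : DifferentiableAt ℝ (fun q : ℝ × ℝ => F q.1 q.2) (p, s)) :
    deriv (fun s' => F p s') s = fderiv ℝ (fun q : ℝ × ℝ => F q.1 q.2) (p, s) (0, 1) := by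
  have h : HasDerivAt (fun s' : ℝ => (p, s')) ((0 : ℝ), (1 : ℝ)) s :=
    (hasDerivAt_const s p).prodMk (hasDerivAt_id s)
  exact (hF.hasFDerivAt.comp_hasDerivAt s h).deriv

theorem contDiffOn_deriv_fst {F : ℝ → ℝ → ℝ} {D : Set (ℝ × ℝ)} (hD : IsOpen D)
    (hF : ContDiffOn ℝ ∞ (fun q : ℝ × ℝ => F q.1 q.2) D) :
    ContDiffOn ℝ ∞ (fun q : ℝ × ℝ => deriv (fun p' => F p' q.2) q.1) D :=
  ((hF.fderiv_of_isOpen hD (m := ∞) (by simp)).clm_apply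
    (contDiffOn_const (c := ((1 : ℝ), (0 : ℝ))))).congr fun _ hq =>
      deriv_fst_eq_fderiv (differentiableAt_of_contDiffOn hD hF hq)

theorem contDiffOn_deriv_snd {F : ℝ → ℝ → ℝ} {D : Set (ℝ × ℝ)} (hD : IsOpen D)
    (hF : ContDiffOn ℝ ∞ (fun q : ℝ × ℝ => F q.1 q.2) D) :
    ContDiffOn ℝ ∞ (fun q : ℝ × ℝ => deriv (fun s' => F q.1 s') q.2) D :=
  ((hF.fderiv_of_isOpen hD (m := ∞) (by simp)).clm_apply
    (contDiffOn_const (c := ((0 : ℝ), (1 : ℝ))))).congr fun _ hq =>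
      deriv_snd_eq_fderiv (differentiableAt_of_contDiffOn hD hF hq)

theorem fderiv_eq_partials {F : ℝ → ℝ → ℝ} {p s : ℝ}
    (hF : DifferentiableAt ℝ (fun q : ℝ × ℝ => F q.1 q.2) (p, s)) (u : ℝ × ℝ) :
    fderiv ℝ (fun q : ℝ × ℝ => F q.1 q.2) (p, s) u
      = deriv (fun p' => F p' s) p * u.1 + deriv (fun s' => F p s') s * u.2 := by
  rw [deriv_fst_eq_fderiv hF, deriv_snd_eq_fderiv hF]
  have : u = u.1 • ((1 : ℝ), (0 : ℝ)) + u.2 • ((0 : ℝ), (1 : ℝ)) := by ext <;> simp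
  conv_lhs => rw [this]
  rw [map_add, map_smul, map_smul, smul_eq_mul, smul_eq_mul, mul_comm, mul_comm u.2]

theorem pd_comp {F : ℝ → ℝ → ℝ} {p S : Pt → ℝ} {x : Pt}
    (hF : DifferentiableAt ℝ (fun q : ℝ × ℝ => F q.1 q.2) (p x, S x))
    (hp : DifferentiableAt ℝ p x) (hS : DifferentiableAt ℝ S x) (m : Fin 4) :
    pd m (fun y => F (p y) (S y)) x
      = deriv (fun p' => F p' (S x)) (p x) * pd m p x
        + deriv (fun s' => F (p x) s') (S x) * pd m S x := by
  have h := (hF.hasFDerivAt.comp x (hp.hasFDerivAt.prodMk hS.hasFDerivAt)).fderiv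
  have h' : fderiv ℝ (fun y => F (p y) (S y)) x = _ := h
  rw [pd, h', ContinuousLinearMap.comp_apply, fderiv_eq_partials hF]
  rfl

theorem pfaff_comp {F : ℝ → ℝ → ℝ} {p S : Pt → ℝ} {x : Pt}
    (hF : DifferentiableAt ℝ (fun q : ℝ × ℝ => F q.1 q.2) (p x, S x))
    (hp : DifferentiableAt ℝ p x) (hS : DifferentiableAt ℝ S x) (e : Fin 4 → Fin 4 → ℝ)
    (α : Fin 4) :
    pfaff e α (fun y => F (p y) (S y)) x
      = deriv (fun p' => F p' (S x)) (p x) * pfaff e α p x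
        + deriv (fun s' => F (p x) s') (S x) * pfaff e α S x := by
  simp only [pfaff, pd_comp hF hp hS, Fin.sum_univ_four]
  ring

theorem pfaff_linear {p S : Pt → ℝ} {x : Pt} (hp : DifferentiableAt ℝ p x)
    (hS : DifferentiableAt ℝ S x) (e : Fin 4 → Fin 4 → ℝ) (α : Fin 4) (r s : ℝ) :
    pfaff e α (fun y => r * p y + s * S y) x = r * pfaff e α p x + s * pfaff e α S x := by
  have h : DifferentiableAt ℝ (fun q : ℝ × ℝ => r * q.1 + s * q.2) (p x, S x) := by fun_prop
  have h1 : deriv (fun p' => r * p' + s * S x) (p x) = r := by simp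
  have h2 : deriv (fun s' => r * p x + s * s') (S x) = s := by simp
  rw [pfaff_comp (F := fun p S => r * p + s * S) h hp hS, h1, h2]

namespace EquationOfState

variable {E : EquationOfState}

theorem differentiableAt_mu {q : ℝ × ℝ} (hq : q ∈ E.dom) :
    DifferentiableAt ℝ (fun q : ℝ × ℝ => E.mu q.1 q.2) q :=
  differentiableAt_of_contDiffOn E.isOpen_dom E.smooth_mu hq

theorem contDiffOn_muP : ContDiffOn ℝ ∞ (fun q : ℝ × ℝ => E.muP q.1 q.2) E.dom :=
  contDiffOn_deriv_fst E.isOpen_dom E.smooth_mu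

theorem contDiffOn_muS : ContDiffOn ℝ ∞ (fun q : ℝ × ℝ => E.muS q.1 q.2) E.dom :=
  contDiffOn_deriv_snd E.isOpen_dom E.smooth_mu

theorem contDiffOn_muPP : ContDiffOn ℝ ∞ (fun q : ℝ × ℝ => E.muPP q.1 q.2) E.dom :=
  contDiffOn_deriv_fst E.isOpen_dom contDiffOn_muP

theorem contDiffOn_muPS : ContDiffOn ℝ ∞ (fun q : ℝ × ℝ => E.muPS q.1 q.2) E.dom :=
  contDiffOn_deriv_snd E.isOpen_dom contDiffOn_muP

theorem differentiableAt_muP {q : ℝ × ℝ} (hq : q ∈ E.dom) :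
    DifferentiableAt ℝ (fun q : ℝ × ℝ => E.muP q.1 q.2) q :=
  differentiableAt_of_contDiffOn E.isOpen_dom contDiffOn_muP hq

/-- The admissible pressures at fixed entropy form an interval, so a positive derivative forces
strict growth. -/
theorem strictMonoOn_mu (hmu : ∀ p s, (p, s) ∈ E.dom → 0 < E.muP p s) (s : ℝ) :
    StrictMonoOn (fun p => E.mu p s) {p : ℝ | (p, s) ∈ E.dom} := by
  refine strictMonoOn_of_deriv_pos (E.ordConnected_dom s).convex (fun p hp => ?_)
    fun p hp => hmu p s (interior_subset (s := {p : ℝ | (p, s) ∈ E.dom}) hp)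
  have h1 : ContinuousAt (fun q : ℝ × ℝ => E.mu q.1 q.2) (p, s) := (differentiableAt_mu hp).continuousAt
  exact (h1.comp (f := fun p' : ℝ => (p', s)) (by fun_prop)).continuousWithinAt

theorem pressure_mu (hmu : ∀ p s, (p, s) ∈ E.dom → 0 < E.muP p s) {p s : ℝ} (h : (p, s) ∈ E.dom) :
    E.pressure (E.mu p s) s = p := by
  have hex : ∃ a ∈ {p : ℝ | (p, s) ∈ E.dom}, (fun p => E.mu p s) a = E.mu p s := ⟨p, h, rfl⟩
  exact (strictMonoOn_mu hmu s).injOn (Function.invFunOn_mem hex) h (Function.invFunOn_eq hex)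

/-- Inverse function theorem for (p,S) ↦ (μ(p,S), S), whose differential is triangular with diagonal
entries μ'_p and 1. -/
theorem contDiffAt_pressure (hmu : ∀ p s, (p, s) ∈ E.dom → 0 < E.muP p s) {p s : ℝ}
    (h : (p, s) ∈ E.dom) :
    ContDiffAt ℝ ∞ (fun q : ℝ × ℝ => E.pressure q.1 q.2) (E.mu p s, s) := by
  have hm : E.muP p s ≠ 0 := (hmu p s h).ne'
  let fwd : ℝ × ℝ →L[ℝ] ℝ × ℝ := (E.muP p s • ContinuousLinearMap.fst ℝ ℝ ℝ
    + E.muS p s • ContinuousLinearMap.snd ℝ ℝ ℝ).prod (ContinuousLinearMap.snd ℝ ℝ ℝ)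
  let bwd : ℝ × ℝ →L[ℝ] ℝ × ℝ := ((E.muP p s)⁻¹ • (ContinuousLinearMap.fst ℝ ℝ ℝ
    - E.muS p s • ContinuousLinearMap.snd ℝ ℝ ℝ)).prod (ContinuousLinearMap.snd ℝ ℝ ℝ)
  let L : (ℝ × ℝ) ≃L[ℝ] (ℝ × ℝ) := ContinuousLinearEquiv.equivOfInverse fwd bwd
    (fun u => by ext <;> simp [fwd, bwd, hm]) (fun u => by ext <;> simp [fwd, bwd, hm])
  let F : ℝ × ℝ → ℝ × ℝ := fun q => (E.mu q.1 q.2, q.2)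
  have hF : ContDiffAt ℝ ∞ F (p, s) :=
    (E.smooth_mu.contDiffAt (E.isOpen_dom.mem_nhds h)).prodMk contDiffAt_snd
  have hd := differentiableAt_mu h
  have hF' : HasFDerivAt F (L : ℝ × ℝ →L[ℝ] ℝ × ℝ) (p, s) := by
    have h1 := hd.hasFDerivAt.prodMk (hasFDerivAt_snd (𝕜 := ℝ) (p := (p, s)))
    refine h1.congr_fderiv ?_
    refine ContinuousLinearMap.ext fun u => Prod.ext ?_ rfl
    exact fderiv_eq_partials hd u
  have hn : (∞ : WithTop ℕ∞) ≠ 0 := by simp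
  have hinv := hF.to_localInverse hF' hn
  have hst : HasStrictFDerivAt F (L : ℝ × ℝ →L[ℝ] ℝ × ℝ) (p, s) := hF.hasStrictFDerivAt' hF' hn
  have hright : ∀ᶠ q in nhds (F (p, s)), F (hF.localInverse hF' hn q) = q :=
    hst.eventually_right_inverse
  have hval : hF.localInverse hF' hn (F (p, s)) = (p, s) := hst.localInverse_apply_image
  have hmem : ∀ᶠ q in nhds (F (p, s)), hF.localInverse hF' hn q ∈ E.dom :=
    hinv.continuousAt.eventually_mem (by rw [hval]; exact E.isOpen_dom.mem_nhds h)
  -- Near the image point the local inverse stays in the admissible set by continuity; there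
  -- `pressure_mu` identifies its first component with the globally chosen pressure.
  refine (contDiffAt_fst.comp (F (p, s)) hinv).congr_of_eventuallyEq ?_
  filter_upwards [hright, hmem] with q hq hq'
  obtain ⟨m, s'⟩ := q
  obtain ⟨h1, h2⟩ := Prod.ext_iff.mp hq
  simp only [F] at h1 h2
  have := pressure_mu hmu (p := (hF.localInverse hF' hn (m, s')).1)
    (s := (hF.localInverse hF' hn (m, s')).2) hq'
  rw [h1, h2] at this
  exact this

end EquationOfState

/-! ### The Euler equations in the frame of the fluid -/

theorem pfaff_congr {Ω : Set Pt} (hΩ : IsOpen Ω) {g k : Pt → ℝ} (hgk : ∀ y ∈ Ω, g y = k y)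
    (e : Fin 4 → Fin 4 → ℝ) (α : Fin 4) {x : Pt} (hx : x ∈ Ω) : pfaff e α g x = pfaff e α k x := by
  simp only [pfaff, pd_congr hΩ hgk _ hx]

theorem pfaff_rho {m p : Pt → ℝ} {x : Pt} (hm : DifferentiableAt ℝ m x)
    (hp : DifferentiableAt ℝ p x) (e : Fin 4 → Fin 4 → ℝ) (α β γ : Fin 4) :
    pfaff e α (fun y => rho (m y) (p y) β γ) x = rho (pfaff e α m x) (pfaff e α p x) β γ := by
  have h : ∀ m p, rho m p β γ = rho 1 0 β γ * m + rho 0 1 β γ * p := by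
    intro m p; simp only [rho]; ring
  simp only [h (m _) (p _)]
  rw [pfaff_linear hm hp, ← h]

theorem pfaff_stressEnergy {m p : Pt → ℝ} {x : Pt} (hm : DifferentiableAt ℝ m x)
    (hp : DifferentiableAt ℝ p x) (e : Fin 4 → Fin 4 → ℝ) (α β γ : Fin 4) :
    pfaff e α (fun y => stressEnergy (m y) (p y) β γ) x
      = stressEnergy (pfaff e α m x) (pfaff e α p x) β γ := by
  have h : ∀ m p, stressEnergy m p β γ = stressEnergy 1 0 β γ * m + stressEnergy 0 1 β γ * p := by
    intro m p; simp only [stressEnergy]; ring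
  simp only [h (m _) (p _)]
  rw [pfaff_linear hm hp, ← h]

namespace IsEinsteinEuler

variable {E : EquationOfState} {Ω : Set Pt} {U : Pt → ℝ} {a : Pt → Fin 3 → Fin 3 → ℝ}
  {b : Pt → Fin 3 → ℝ} {p S : Pt → ℝ}

theorem smoothFrame (hΩ : IsOpen Ω) (h : IsEinsteinEuler E Ω U a b p S) : SmoothFrame Ω U a b where
  isOpen := hΩ
  smooth_U := h.smooth_U
  smooth_a i j := contDiffOn_pi.mp (contDiffOn_pi.mp h.smooth_a i) j
  smooth_b := contDiffOn_pi.mp h.smooth_b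
  lapse_ne_zero := h.lapse_ne_zero
  det_ne_zero := h.det_ne_zero

theorem smooth_density (h : IsEinsteinEuler E Ω U a b p S) :
    ContDiffOn ℝ ∞ (fun y => E.mu (p y) (S y)) Ω :=
  E.smooth_mu.comp (h.smooth_p.prodMk h.smooth_S) h.mem_dom

theorem smooth_muP (h : IsEinsteinEuler E Ω U a b p S) :
    ContDiffOn ℝ ∞ (fun y => E.muP (p y) (S y)) Ω :=
  EquationOfState.contDiffOn_muP.comp (h.smooth_p.prodMk h.smooth_S) h.mem_dom

theorem pfaff_entropy_zero (h : IsEinsteinEuler E Ω U a b p S) {x : Pt} (hx : x ∈ Ω) :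
    pfaff (frame (U x) (a x) (b x)) 0 S x = 0 := by
  have := h.entropy x hx
  simpa [velocity, Fin.sum_univ_succ] using this

theorem pfaff_density (hΩ : IsOpen Ω) (h : IsEinsteinEuler E Ω U a b p S) {x : Pt} (hx : x ∈ Ω)
    (α : Fin 4) :
    pfaff (frame (U x) (a x) (b x)) α (fun y => E.mu (p y) (S y)) x
      = E.muP (p x) (S x) * pfaff (frame (U x) (a x) (b x)) α p x
        + E.muS (p x) (S x) * pfaff (frame (U x) (a x) (b x)) α S x :=
  pfaff_comp (EquationOfState.differentiableAt_mu (h.mem_dom x hx))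
    (differentiableAt_of_contDiffOn hΩ h.smooth_p hx)
    (differentiableAt_of_contDiffOn hΩ h.smooth_S hx) _ _

theorem pfaff_muP (hΩ : IsOpen Ω) (h : IsEinsteinEuler E Ω U a b p S) {x : Pt} (hx : x ∈ Ω)
    (α : Fin 4) :
    pfaff (frame (U x) (a x) (b x)) α (fun y => E.muP (p y) (S y)) x
      = E.muPP (p x) (S x) * pfaff (frame (U x) (a x) (b x)) α p x
        + E.muPS (p x) (S x) * pfaff (frame (U x) (a x) (b x)) α S x :=
  pfaff_comp (EquationOfState.differentiableAt_muP (h.mem_dom x hx))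
    (differentiableAt_of_contDiffOn hΩ h.smooth_p hx)
    (differentiableAt_of_contDiffOn hΩ h.smooth_S hx) _ _

theorem euler_stressEnergy (hΩ : IsOpen Ω) (h : IsEinsteinEuler E Ω U a b p S) {x : Pt}
    (hx : x ∈ Ω) (β : Fin 4) :
    ∑ α, (stressEnergy (pfaff (frame (U x) (a x) (b x)) α (fun y => E.mu (p y) (S y)) x)
          (pfaff (frame (U x) (a x) (b x)) α p x) α β
        + ∑ γ, (cfConn U a b x α γ α * stressEnergy (E.mu (p x) (S x)) (p x) γ β
          + cfConn U a b x α γ β * stressEnergy (E.mu (p x) (S x)) (p x) α γ)) = 0 := by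
  rw [← h.euler x hx β]
  refine Finset.sum_congr rfl fun α _ => ?_
  rw [pfaff_stressEnergy (differentiableAt_of_contDiffOn hΩ h.smooth_density hx)
    (differentiableAt_of_contDiffOn hΩ h.smooth_p hx)]

/-- Energy balance, the component β = 0 of the divergence. -/
theorem pfaff_density_zero (hΩ : IsOpen Ω) (h : IsEinsteinEuler E Ω U a b p S) {x : Pt}
    (hx : x ∈ Ω) :
    pfaff (frame (U x) (a x) (b x)) 0 (fun y => E.mu (p y) (S y)) x
      = -((E.mu (p x) (S x) + p x) * ∑ i : Fin 3, cfConn U a b x i.succ 0 i.succ) := by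
  have h0 := h.euler_stressEnergy hΩ hx 0
  have hz := cfConn_zero_zero U a b x
  have hs := cfConn_succ_zero U a b x
  simp only [Fin.sum_univ_succ (n := 3), Fin.sum_univ_three, hz, hs, stressEnergy, velocity, eta,
    eps, Fin.succ_ne_zero, if_true, if_false, (Fin.succ_ne_zero _).symm, Fin.succ_inj] at h0 ⊢
  simp at h0 ⊢
  linear_combination h0

/-- Momentum balance, the component β = i. The rotation of the frame does not contribute, since
T^{0j} = 0. -/
theorem pfaff_pressure_succ (hΩ : IsOpen Ω) (h : IsEinsteinEuler E Ω U a b p S) {x : Pt}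
    (hx : x ∈ Ω) (i : Fin 3) :
    pfaff (frame (U x) (a x) (b x)) i.succ p x
      = -((E.mu (p x) (S x) + p x) * cfConn U a b x 0 0 i.succ) := by
  have h0 := h.euler_stressEnergy hΩ hx i.succ
  have hz := cfConn_zero_zero U a b x
  have hs := cfConn_succ_zero U a b x
  have ha := cfConn_succ_succ U a b x
  simp only [Fin.sum_univ_succ (n := 3), Fin.sum_univ_three, hz, hs, stressEnergy, velocity, eta,
    eps, Fin.succ_ne_zero, if_true, if_false, (Fin.succ_ne_zero _).symm, Fin.succ_inj] at h0 ⊢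
  -- Antisymmetry of ω_{ji}^k in i and k cancels the purely spatial terms p(ω_{ji}^j + ω_{jj}^i) and
  -- leaves (μ+p) Y_i.
  have d : ∀ γ (i : Fin 3), cfConn U a b x γ i.succ i.succ = 0 := fun γ i => by
    linarith [ha γ i i]
  have a1 := ha 1 1 0
  have a2 := ha 2 1 0
  have b1 := ha 1 2 0
  have b3 := ha 3 2 0
  have c2 := ha 2 2 1
  have c3 := ha 3 2 1
  have d1 := d 1
  have d2 := d 2
  have d3 := d 3
  simp only [Fin.forall_fin_succ] at d1 d2 d3
  fin_cases i <;> simp at h0 a1 a2 b1 b3 c2 c3 d1 d2 d3 ⊢ <;>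
    simp [a1, a2, b1, b3, c2, c3, d1, d2, d3] at h0 ⊢ <;> linear_combination h0

end IsEinsteinEuler

/-! ### Evolution of the coframe coefficients -/

namespace SmoothFrame

variable {Ω : Set Pt} {U : Pt → ℝ} {a : Pt → Fin 3 → Fin 3 → ℝ} {b : Pt → Fin 3 → ℝ}

/-- The form θ^i has no dx⁰ component and e_0 is a multiple of ∂/∂x⁰, so one derivative of a
survives. -/
theorem structCoeff_zero_succ (U : Pt → ℝ) (a : Pt → Fin 3 → Fin 3 → ℝ) (b : Pt → Fin 3 → ℝ) (x : Pt)
    (k i : Fin 3) :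
    structCoeff (fun y => coframe (U y) (a y) (b y)) (fun y => frame (U y) (a y) (b y)) x
        0 k.succ i.succ
      = -∑ n, pfaff (frame (U x) (a x) (b x)) 0 (fun y => a y i n) x
          * (Matrix.of (a x))⁻¹ n k := by
  simp [structCoeff, pfaff, coframe, frame, Fin.sum_univ_succ (n := 3), pd_const]
  simp only [Fin.sum_univ_three]
  ring

/-- As for θ^i, but the component U dx⁰ of θ^0 adds the spatial derivatives of U. -/
theorem structCoeff_zero_zero (U : Pt → ℝ) (a : Pt → Fin 3 → Fin 3 → ℝ) (b : Pt → Fin 3 → ℝ) (x : Pt)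
    (k : Fin 3) :
    structCoeff (fun y => coframe (U y) (a y) (b y)) (fun y => frame (U y) (a y) (b y)) x
        0 k.succ 0
      = -∑ n : Fin 3, (pfaff (frame (U x) (a x) (b x)) 0 (fun y => b y n) x
          - (U x)⁻¹ * pd n.succ U x) * (Matrix.of (a x))⁻¹ n k := by
  simp [structCoeff, pfaff, coframe, frame, Fin.sum_univ_succ (n := 3)]
  simp only [Fin.sum_univ_three]
  ring

theorem sum_inv_mul (h : SmoothFrame Ω U a b) {x : Pt} (hx : x ∈ Ω) (n j : Fin 3) :
    ∑ k, (Matrix.of (a x))⁻¹ n k * a x k j = if n = j then 1 else 0 := by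
  have hinv : (Matrix.of (a x))⁻¹ * Matrix.of (a x) = 1 :=
    Matrix.nonsing_inv_mul _ (isUnit_iff_ne_zero.mpr (h.det_ne_zero x hx))
  simpa [Matrix.mul_apply, Matrix.one_apply] using congrFun (congrFun hinv n) j

/-- Zero torsion equates the connection difference with c_{0k}^i, which contains ∂_0 a multiplied by
a⁻¹; multiplication by a isolates ∂_0 a. -/
theorem pfaff_frame_a (h : SmoothFrame Ω U a b) {x : Pt} (hx : x ∈ Ω) (i j : Fin 3) :
    pfaff (frame (U x) (a x) (b x)) 0 (fun y => a y i j) x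
      = ∑ k : Fin 3, a x k j * (cfConn U a b x k.succ 0 i.succ - cfConn U a b x 0 k.succ i.succ) := by
  have hk : ∀ k : Fin 3, cfConn U a b x k.succ 0 i.succ - cfConn U a b x 0 k.succ i.succ
      = ∑ n, pfaff (frame (U x) (a x) (b x)) 0 (fun y => a y i n) x
          * (Matrix.of (a x))⁻¹ n k := by
    intro k
    have := cfConn_torsion U a b x 0 k.succ i.succ
    rw [structCoeff_zero_succ] at this
    linear_combination -this
  have hs : ∑ k : Fin 3, a x k j * (cfConn U a b x k.succ 0 i.succ - cfConn U a b x 0 k.succ i.succ)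
      = ∑ n, pfaff (frame (U x) (a x) (b x)) 0 (fun y => a y i n) x
          * ∑ k, (Matrix.of (a x))⁻¹ n k * a x k j := by
    simp only [hk, Fin.sum_univ_three]; ring
  rw [hs]
  simp [h.sum_inv_mul hx]

theorem pfaff_frame_b (h : SmoothFrame Ω U a b) {x : Pt} (hx : x ∈ Ω) (i : Fin 3) :
    pfaff (frame (U x) (a x) (b x)) 0 (fun y => b y i) x
      = (∑ k : Fin 3, a x k i * (-cfConn U a b x 0 0 k.succ
          + (U x)⁻¹ * pfaff (frame (U x) (a x) (b x)) k.succ U x))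
        + (U x)⁻¹ * b x i * pfaff (frame (U x) (a x) (b x)) 0 U x := by
  have hk : ∀ k : Fin 3, cfConn U a b x 0 0 k.succ
      = -∑ n : Fin 3, (pfaff (frame (U x) (a x) (b x)) 0 (fun y => b y n) x
          - (U x)⁻¹ * pd n.succ U x) * (Matrix.of (a x))⁻¹ n k := by
    intro k
    have := cfConn_torsion U a b x 0 k.succ 0
    rw [structCoeff_zero_zero, cfConn_succ_zero, cfConn_zero_zero, sub_zero] at this
    exact this
  -- The vector e_k has a component along ∂/∂x⁰, so the coordinate derivatives of U in c_{0k}^0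
  -- differ from Pfaff derivatives by b_n ∂_0 U.
  have hU : ∀ k : Fin 3, pfaff (frame (U x) (a x) (b x)) k.succ U x
      = ∑ n : Fin 3, (pd n.succ U x - b x n * pfaff (frame (U x) (a x) (b x)) 0 U x)
          * (Matrix.of (a x))⁻¹ n k := by
    intro k
    simp [pfaff, frame, Fin.sum_univ_succ (n := 3)]
    simp only [Fin.sum_univ_three]
    ring
  have hs : ∑ k : Fin 3, a x k i * (-cfConn U a b x 0 0 k.succ
          + (U x)⁻¹ * pfaff (frame (U x) (a x) (b x)) k.succ U x)
      = ∑ n : Fin 3, (pfaff (frame (U x) (a x) (b x)) 0 (fun y => b y n) x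
          - (U x)⁻¹ * b x n * pfaff (frame (U x) (a x) (b x)) 0 U x)
          * ∑ k, (Matrix.of (a x))⁻¹ n k * a x k i := by
    simp only [hk, hU, Fin.sum_univ_three]; ring
  rw [hs]
  simp [h.sum_inv_mul hx]

end SmoothFrame

/-! ### The EEF equations for a fluid spacetime -/

namespace IsEinsteinEuler

variable {E : EquationOfState} {Ω : Set Pt} {U : Pt → ℝ} {a : Pt → Fin 3 → Fin 3 → ℝ}
  {b : Pt → Fin 3 → ℝ} {p S : Pt → ℝ} {f : Pt → Fin 3 → Fin 3 → ℝ}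

variable {x : Pt}

theorem pressure_unknowns (h : IsEinsteinEuler E Ω U a b p S)
    (hmu : ∀ p s, (p, s) ∈ E.dom → 0 < E.muP p s) (hx : x ∈ Ω) :
    (unknowns E U a b p S x).pressure E = p x :=
  EquationOfState.pressure_mu hmu (h.mem_dom x hx)

theorem muP_unknowns (h : IsEinsteinEuler E Ω U a b p S)
    (hmu : ∀ p s, (p, s) ∈ E.dom → 0 < E.muP p s) (hx : x ∈ Ω) :
    (unknowns E U a b p S x).muP E = E.muP (p x) (S x) := by
  rw [State.muP, h.pressure_unknowns hmu hx]; rfl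

theorem dS_unknowns (h : IsEinsteinEuler E Ω U a b p S) (hx : x ∈ Ω) (α : Fin 4) :
    (unknowns E U a b p S x).dS α = pfaff (frame (U x) (a x) (b x)) α S x := by
  induction α using Fin.cases with
  | zero => exact (h.pfaff_entropy_zero hx).symm
  | succ i => rfl

/-- The spatial components are momentum balance. For the time component, ∂_0 S = 0 gives ∂_0 μ =
μ'_p ∂_0 p, and energy balance is divided by μ'_p. -/
theorem dp_unknowns (hΩ : IsOpen Ω) (h : IsEinsteinEuler E Ω U a b p S)
    (hmu : ∀ p s, (p, s) ∈ E.dom → 0 < E.muP p s) (hx : x ∈ Ω) (α : Fin 4) :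
    (unknowns E U a b p S x).dp E α = pfaff (frame (U x) (a x) (b x)) α p x := by
  have hpr := h.pressure_unknowns hmu hx
  rw [State.dp, hpr]
  induction α using Fin.cases with
  | zero =>
    have h1 := h.pfaff_density hΩ hx 0
    rw [h.pfaff_density_zero hΩ hx, h.pfaff_entropy_zero hx, mul_zero, add_zero] at h1
    have h2 : E.muP (p x) (S x) ≠ 0 := (hmu _ _ (h.mem_dom x hx)).ne'
    rw [State.G, Fin.cons_zero, h.muP_unknowns hmu hx]
    change (E.mu (p x) (S x) + p x) * -((∑ i : Fin 3, cfConn U a b x i.succ 0 i.succ)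
      / E.muP (p x) (S x)) = _
    field_simp
    linear_combination h1
  | succ i =>
    rw [h.pfaff_pressure_succ hΩ hx]
    change (E.mu (p x) (S x) + p x) * -cfConn U a b x 0 0 i.succ = _
    ring

theorem dmu_unknowns (hΩ : IsOpen Ω) (h : IsEinsteinEuler E Ω U a b p S)
    (hmu : ∀ p s, (p, s) ∈ E.dom → 0 < E.muP p s) (hx : x ∈ Ω) (α : Fin 4) : (unknowns E U a b p S x).dmu E α
    = pfaff (frame (U x) (a x) (b x)) α (fun y => E.mu (p y) (S y)) x := by
  rw [State.dmu, h.dp_unknowns hΩ hmu hx, h.dS_unknowns hx, h.pfaff_density hΩ hx,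
    h.muP_unknowns hmu hx, h.pressure_unknowns hmu hx]
  rfl

theorem dmuP_unknowns (hΩ : IsOpen Ω) (h : IsEinsteinEuler E Ω U a b p S)
    (hmu : ∀ p s, (p, s) ∈ E.dom → 0 < E.muP p s) (hx : x ∈ Ω) (α : Fin 4) : (unknowns E U a b p S x).dmuP E α
    = pfaff (frame (U x) (a x) (b x)) α (fun y => E.muP (p y) (S y)) x := by
  rw [State.dmuP, h.dp_unknowns hΩ hmu hx, h.dS_unknowns hx, h.pfaff_muP hΩ hx,
    h.pressure_unknowns hmu hx]
  rfl

/-- The Einstein equations hold throughout Ω, so Ricci may be replaced by ρ before differentiating.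
-/
theorem nablaRho_unknowns (hΩ : IsOpen Ω) (h : IsEinsteinEuler E Ω U a b p S)
    (hmu : ∀ p s, (p, s) ∈ E.dom → 0 < E.muP p s) (hx : x ∈ Ω) (hf : ∀ i j : Fin 3, cfConn U a b x 0 i.succ j.succ = f x i j)
    (α β γ : Fin 4) : (unknowns E U a b p S x).nablaRho E (f x) α β γ
      = (nabla2 (h.smoothFrame hΩ).der (h.smoothFrame hΩ).connFun
          (ricciA (h.smoothFrame hΩ).der (h.smoothFrame hΩ).connFun) α β γ).1 ⟨x, hx⟩ := by
  have hS := h.smoothFrame hΩ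
  have hR : ∀ β γ, Represents (ricciA hS.der hS.connFun β γ)
      fun y => rho (E.mu (p y) (S y)) (p y) β γ := fun β γ =>
    (hS.represents_ricciA β γ).congr fun y hy => h.einstein y hy β γ
  have hw := hS.represents_connFun
  have h1 : Represents (nabla2 hS.der hS.connFun (ricciA hS.der hS.connFun) α β γ) _ :=
    (hS.represents_der (hR _ _) _).sub <| .sum fun s =>
      ((hw α β s).mul (hR s γ)).add ((hw α γ s).mul (hR β s))
  rw [h1 x hx, State.nablaRho, pfaff_rho (differentiableAt_of_contDiffOn hΩ h.smooth_density hx)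
    (differentiableAt_of_contDiffOn hΩ h.smooth_p hx), h.dp_unknowns hΩ hmu hx,
    h.dmu_unknowns hΩ hmu hx, h.pressure_unknowns hmu hx]
  simp only [SmoothFrame.conn_unknowns E p S hf]
  rfl

theorem G_unknowns (hΩ : IsOpen Ω) (h : IsEinsteinEuler E Ω U a b p S)
    (hmu : ∀ p s, (p, s) ∈ E.dom → 0 < E.muP p s)
    (hne : ∀ p s, (p, s) ∈ E.dom → E.mu p s + p ≠ 0) (hx : x ∈ Ω) (α : Fin 4) :
    (unknowns E U a b p S x).G E α
      = pfaff (frame (U x) (a x) (b x)) α p x * (E.mu (p x) (S x) + p x)⁻¹ := by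
  rw [← h.dp_unknowns hΩ hmu hx, State.dp, h.pressure_unknowns hmu hx]
  have := hne _ _ (h.mem_dom x hx)
  change _ = (E.mu (p x) (S x) + p x) * _ * _
  field_simp

theorem smooth_G (hΩ : IsOpen Ω) (h : IsEinsteinEuler E Ω U a b p S)
    (hmu : ∀ p s, (p, s) ∈ E.dom → 0 < E.muP p s)
    (hne : ∀ p s, (p, s) ∈ E.dom → E.mu p s + p ≠ 0) (α : Fin 4) :
    ContDiffOn ℝ ∞ (fun y => (unknowns E U a b p S y).G E α) Ω :=
  ((((h.smoothFrame hΩ).represents_der (represents_restr p h.smooth_p) α).contDiffOn).mul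
    ((h.smooth_density.add h.smooth_p).inv fun y hy => hne _ _ (h.mem_dom y hy))).congr
    fun _ hy => h.G_unknowns hΩ hmu hne hy α

/-- Leibniz rule for X_k^k = -μ'_p G_0, which holds on all of Ω. -/
theorem pfaff_trX (hΩ : IsOpen Ω) (h : IsEinsteinEuler E Ω U a b p S)
    (hmu : ∀ p s, (p, s) ∈ E.dom → 0 < E.muP p s)
    (hne : ∀ p s, (p, s) ∈ E.dom → E.mu p s + p ≠ 0) (hx : x ∈ Ω) (α : Fin 4) :
    ∑ k : Fin 3, pfaff (frame (U x) (a x) (b x)) α (fun y => cfConn U a b y k.succ 0 k.succ) x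
      = -((unknowns E U a b p S x).muP E
          * pfaff (frame (U x) (a x) (b x)) α (fun y => (unknowns E U a b p S y).G E 0) x
        + (unknowns E U a b p S x).G E 0 * (unknowns E U a b p S x).dmuP E α) := by
  have hS := h.smoothFrame hΩ
  have rG := represents_restr _ (h.smooth_G hΩ hmu hne 0)
  have rP := represents_restr _ h.smooth_muP
  have rX := fun k : Fin 3 => hS.represents_connFun k.succ 0 k.succ
  have e : ∑ k : Fin 3, hS.connFun k.succ 0 k.succ
      = -(restr _ (h.smooth_G hΩ hmu hne 0) * restr _ h.smooth_muP) := by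
    refine (Represents.sum rX).eq ((rG.mul rP).neg.congr fun y hy => ?_)
    have h2 : E.muP (p y) (S y) ≠ 0 := (hmu _ _ (h.mem_dom y hy)).ne'
    rw [State.G, Fin.cons_zero, h.muP_unknowns hmu hy]
    field_simp
    rfl
  have e1 := congrArg (hS.der α) e
  rw [map_sum, map_neg, Derivation.leibniz] at e1
  have e2 : Represents (∑ k : Fin 3, hS.der α (hS.connFun k.succ 0 k.succ)) _ :=
    .sum fun k => hS.represents_der (rX k) α
  rw [e1] at e2
  rw [e2.eqOn (((rG.mul (hS.represents_der rP α)).add (rP.mul (hS.represents_der rG α))).neg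
    ) hx, h.dmuP_unknowns hΩ hmu hx, h.muP_unknowns hmu hx]
  ring

/-- Here G is dp divided by μ+p. Its curl consists of the commutator term and of a term in d(μ+p) ∧
dp, in which only the μ'_S dS part of d(μ+p) survives. -/
theorem curlG_unknowns (hΩ : IsOpen Ω) (h : IsEinsteinEuler E Ω U a b p S)
    (hmu : ∀ p s, (p, s) ∈ E.dom → 0 < E.muP p s)
    (hne : ∀ p s, (p, s) ∈ E.dom → E.mu p s + p ≠ 0)
    {x : Pt} (hx : x ∈ Ω) (hf : ∀ i j : Fin 3, cfConn U a b x 0 i.succ j.succ = f x i j)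
    (α β : Fin 4) : (unknowns E U a b p S x).curlG E (f x) α β
      = pfaff (frame (U x) (a x) (b x)) α (fun y => (unknowns E U a b p S y).G E β) x
        - pfaff (frame (U x) (a x) (b x)) β (fun y => (unknowns E U a b p S y).G E α) x := by
  have hS := h.smoothFrame hΩ
  have hq : ContDiffOn ℝ ∞ (fun y => (E.mu (p y) (S y) + p y)⁻¹) Ω :=
    (h.smooth_density.add h.smooth_p).inv fun y hy => hne _ _ (h.mem_dom y hy)
  have rq := represents_restr _ hq
  have rm := represents_restr _ h.smooth_density
  have rp := represents_restr _ h.smooth_p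
  set q := restr _ hq
  set m := restr _ h.smooth_density
  set p' := restr _ h.smooth_p
  -- The reciprocal of μ+p is characterised by this product, so that its derivatives follow from the
  -- Leibniz rule.
  have hmq : (m + p') * q = 1 := (((rm.add rp).mul rq).congr fun y hy =>
    mul_inv_cancel₀ (hne _ _ (h.mem_dom y hy))).eq .one
  have hDq : ∀ α, hS.der α q = -(hS.der α m + hS.der α p') * q * q := by
    intro α
    have h1 := congrArg (hS.der α) hmq
    rw [Derivation.leibniz, Derivation.map_one_eq_zero, smul_eq_mul, smul_eq_mul, map_add] at h1
    linear_combination q * h1 - hS.der α q * hmq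
  have rG : ∀ β, Represents (hS.der β p' * q) fun y => (unknowns E U a b p S y).G E β := fun β =>
    ((hS.represents_der rp β).mul rq).congr fun y hy => (h.G_unknowns hΩ hmu hne hy β).symm
  have key : hS.der α (hS.der β p' * q) - hS.der β (hS.der α p' * q)
      = ∑ γ, hS.structFun α β γ * (hS.der γ p' * q)
        - (hS.der α m * (hS.der β p' * q) - hS.der β m * (hS.der α p' * q)) * q := by
    have hc := hS.commutes α β p'
    have : ∑ γ, hS.structFun α β γ * (hS.der γ p' * q)
        = (∑ γ, hS.structFun α β γ * hS.der γ p') * q := by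
      rw [Finset.sum_mul]; simp only [mul_assoc]
    rw [this, ← hc]
    simp only [Derivation.leibniz, smul_eq_mul, hDq]
    ring
  have e1 := (hS.represents_der (rG β) α).sub (hS.represents_der (rG α) β)
  rw [key] at e1
  have e2 := e1.eqOn ((Represents.sum fun γ => (hS.represents_structFun α β γ).mul (rG γ)).sub
    ((((hS.represents_der rm α).mul (rG β)).sub ((hS.represents_der rm β).mul (rG α))).mul rq)) hx
  rw [e2, State.curlG, h.pressure_unknowns hmu hx, h.dS_unknowns hx,
    h.dS_unknowns hx, h.pfaff_density hΩ hx, h.pfaff_density hΩ hx,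
    h.G_unknowns hΩ hmu hne hx α, h.G_unknowns hΩ hmu hne hx β]
  simp only [State.comm, SmoothFrame.conn_unknowns E p S hf, cfConn_torsion]
  change _ - E.muS (p x) (S x) / (E.mu (p x) (S x) + p x) * _ = _
  ring

/-- The unknowns of a fluid spacetime satisfy the Einstein-Euler-Friedrich system. -/
theorem eefSystem (hΩ : IsOpen Ω) (h : IsEinsteinEuler E Ω U a b p S)
    (hmu : ∀ p s, (p, s) ∈ E.dom → 0 < E.muP p s)
    (hne : ∀ p s, (p, s) ∈ E.dom → E.mu p s + p ≠ 0)
    (hf : ∀ x ∈ Ω, ∀ i j : Fin 3, cfConn U a b x 0 i.succ j.succ = f x i j)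
    {x : Pt} (hx : x ∈ Ω) : EEFSystem E U f (unknowns E U a b p S) x := by
  have hS := h.smoothFrame hΩ
  have hpr := h.pressure_unknowns hmu hx
  have hconn := SmoothFrame.conn_unknowns E p S (hf x hx)
  have hconn' : (unknowns E U a b p S x).conn (f x) = cfConn U a b x := by
    funext α β γ; exact hconn α β γ
  have hriem := hS.riem_unknowns E p S hx
  have hnR := hS.nablaRiem_unknowns E p S hx (hf x hx)
  let ev : SmoothFun Ω →+* ℝ := (Pi.evalRingHom (fun _ : Ω => ℝ) ⟨x, hx⟩).comp
    (SmoothFun Ω).subtype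
  have hev : ∀ F : SmoothFun Ω, F.1 ⟨x, hx⟩ = ev F := fun _ => rfl
  -- The redundant zero term gives the shape required by `pfaff_linear`.
  have hY : ∀ i : Fin 3, (fun y => (unknowns E U a b p S y).G E i.succ)
      = fun y => -1 * cfConn U a b y 0 0 i.succ + 0 * cfConn U a b y 0 0 i.succ := by
    intro i; funext y
    change -cfConn U a b y 0 0 i.succ = _
    ring
  have hwd : ∀ α β γ, DifferentiableAt ℝ (fun y => cfConn U a b y α β γ) x := fun α β γ =>
    differentiableAt_of_contDiffOn hΩ (hS.contDiffOn_cfConn α β γ) hx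
  have hpY : ∀ α (i : Fin 3), pfaff (frame (U x) (a x) (b x)) α
      (fun y => (unknowns E U a b p S y).G E i.succ) x
      = -pfaff (frame (U x) (a x) (b x)) α (fun y => cfConn U a b y 0 0 i.succ) x := by
    intro α i
    rw [hY, pfaff_linear (hwd _ _ _) (hwd _ _ _)]
    ring
  refine ⟨?_, ?_, ?_, ?_, ?_, ?_, ?_, ?_, ?_, ?_⟩
  · intro Q i k
    have h1 := congrArg ev (nabla4_second_bianchi hS.commutes hS.jacobi hS.connFun_torsion
      hS.connFun_metric 0 i.succ k.succ Q.fst Q.snd)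
    -- The cyclic identity contains ∇_h R_{k0}; the system uses -∇_h R_{0k}.
    rw [nabla4_antisymm curvDown_antisymm i.succ k.succ 0, map_add, map_add, map_neg, map_zero]
      at h1
    rw [hnR, hnR, hnR, hev, hev, hev]
    linear_combination h1
  · intro Q i
    have h1 := congrArg ev (contracted_bianchi hS.commutes hS.jacobi
      hS.connFun_torsion hS.connFun_metric Q.fst Q.snd i.succ)
    have he : ∀ α, ev (epsA _ α) = eps α := fun _ => rfl
    rw [Fin.sum_univ_succ, map_add, map_sum, map_mul, map_sub] at h1
    simp only [map_mul, he, eps, Fin.succ_ne_zero, if_true, if_false, one_mul] at h1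
    simp only [hnR, State.sourceJ, h.nablaRho_unknowns hΩ hmu hx (hf x hx), hev]
    rw [← h1, neg_one_mul]
  · intro i j
    change pfaff (frame (U x) (a x) (b x)) 0 (fun y => a y i j) x = _
    rw [hS.pfaff_frame_a hx]
    simp only [hf x hx]
    rfl
  · intro i
    exact hS.pfaff_frame_b hx i
  · intro k j i
    -- The rotation coefficients equal f on the whole open set, so their derivatives agree as well.
    rw [hriem, hconn', riemannDown, riemannUp, pfaff_congr hΩ (fun y hy => (hf y hy j i).symm) _ _ hx]
    simp only [eps, Fin.succ_ne_zero, if_false, one_mul]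
    rfl
  · intro k i
    rw [hriem, hconn', riemannDown, riemannUp, h.curlG_unknowns hΩ hmu hne hx (hf x hx), hpY, hpY]
    simp only [eps, Fin.succ_ne_zero, if_false, one_mul]
    change pfaff (frame (U x) (a x) (b x)) 0 (fun y => cfConn U a b y k.succ 0 i.succ) x
      - pfaff (frame (U x) (a x) (b x)) i.succ (fun y => cfConn U a b y 0 0 k.succ) x = _
    ring
  · intro i
    -- Antisymmetry in the second pair removes the time term from the trace R_{i0}, leaving the sum
    -- over k of the system.
    have h0 : riemannUp (fun y => frame (U y) (a y) (b y)) (cfConn U a b) x 0 i.succ 0 0 = 0 := by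
      have := hS.riemannDown_antisymm_right hx 0 i.succ 0 0
      simp only [riemannDown, eps, if_true] at this
      linarith
    have hR := h.einstein x hx i.succ 0
    have hrho : rho (E.mu (p x) (S x)) (p x) i.succ 0 = 0 := by
      simp [rho, velocity, eta]
    rw [hrho, ricci, Fin.sum_univ_succ, h0, zero_add] at hR
    simp only [riemannUp, Finset.sum_add_distrib, Finset.sum_sub_distrib] at hR
    have hT := h.pfaff_trX hΩ hmu hne hx i.succ
    rw [hconn', h.curlG_unknowns hΩ hmu hne hx (hf x hx), hpY]
    change _ * pfaff (frame (U x) (a x) (b x)) 0 (fun y => cfConn U a b y 0 0 i.succ) x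
      - ∑ k : Fin 3, pfaff (frame (U x) (a x) (b x)) k.succ
        (fun y => cfConn U a b y i.succ 0 k.succ) x = _
    -- R_{i0} = 0 supplies ∂_i X_k^k, and `pfaff_trX` rewrites it through ∂_i G_0, which the curl
    -- exchanges for ∂_0 G_i = -∂_0 Y_i.
    linear_combination -hR - hT
  · rw [hpr]
    change pfaff (frame (U x) (a x) (b x)) 0 (fun y => E.mu (p y) (S y)) x
      + (E.mu (p x) (S x) + p x) * ∑ i : Fin 3, cfConn U a b x i.succ 0 i.succ = 0
    rw [h.pfaff_density_zero hΩ hx]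
    ring
  · exact h.pfaff_entropy_zero hx
  · intro k
    change pfaff (frame (U x) (a x) (b x)) 0
      (fun y => pfaff (frame (U y) (a y) (b y)) k.succ S y) x
      = ∑ j : Fin 3, (f x k j - cfConn U a b x k.succ 0 j.succ)
        * pfaff (frame (U x) (a x) (b x)) j.succ S x
    have h1 := hS.pfaff_commutator h.smooth_S 0 k.succ hx
    -- ∂_0 S vanishes on a neighbourhood, hence so does ∂_k ∂_0 S; the commutator alone then
    -- determines ∂_0 S_k.
    have h2 : pfaff (frame (U x) (a x) (b x)) k.succ
        (fun y => pfaff (frame (U y) (a y) (b y)) 0 S y) x = 0 := by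
      rw [pfaff_congr hΩ (fun y hy => h.pfaff_entropy_zero hy) _ _ hx]
      simp [pfaff, pd_const]
    rw [h2, Fin.sum_univ_succ, h.pfaff_entropy_zero hx, sub_zero, mul_zero, zero_add] at h1
    rw [h1]
    simp only [hf x hx]

end IsEinsteinEuler

/-! ### The symmetric form of the system -/

theorem ofPairs_pair (φ : Pair → ℝ) (P : Pair) : ofPairs φ P.fst P.snd = φ P := by
  rcases P with i | i <;> fin_cases i <;> rfl

theorem ofPairs_antisymm (φ : Pair → ℝ) (α β : Fin 4) : ofPairs φ α β = -ofPairs φ β α := by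
  fin_cases α <;> fin_cases β <;> simp [ofPairs]

theorem ofPairs_add (φ ψ : Pair → ℝ) (α β : Fin 4) :
    ofPairs (fun P => φ P + ψ P) α β = ofPairs φ α β + ofPairs ψ α β := by
  fin_cases α <;> fin_cases β <;> simp [ofPairs] <;> ring

theorem ofPairs_smul (r : ℝ) (φ : Pair → ℝ) (α β : Fin 4) :
    ofPairs (fun P => r * φ P) α β = r * ofPairs φ α β := by
  fin_cases α <;> fin_cases β <;> simp [ofPairs]

theorem ofPairs_zero (α β : Fin 4) : ofPairs (fun _ => 0) α β = 0 := by
  simpa using ofPairs_smul 0 (fun _ => 0) α β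

theorem State.riem_pair (z : State) (α β : Fin 4) (Q : Pair) :
    z.riem α β Q.fst Q.snd = ofPairs (fun P => z (.R P Q)) α β := by
  simp only [State.riem, ofPairs_pair]

theorem State.riem_antisymm (z : State) (α β l μ : Fin 4) :
    z.riem α β l μ = -z.riem β α l μ := ofPairs_antisymm _ _ _

theorem State.riem_zero (α β l μ : Fin 4) : State.riem 0 α β l μ = 0 := by
  simp [State.riem, ofPairs_zero]

theorem State.nablaRiem_antisymm (z : State) (f : Fin 3 → Fin 3 → ℝ) (d : Fin 4 → State)
    (α β γ l μ : Fin 4) : z.nablaRiem f d α β γ l μ = -z.nablaRiem f d α γ β l μ := by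
  have e : ∀ s, z.conn f α β s * z.riem s γ l μ + z.conn f α γ s * z.riem β s l μ
      + z.conn f α l s * z.riem β γ s μ + z.conn f α μ s * z.riem β γ l s
      = -(z.conn f α γ s * z.riem s β l μ + z.conn f α β s * z.riem γ s l μ
      + z.conn f α l s * z.riem γ β s μ + z.conn f α μ s * z.riem γ β l s) := by
    intro s
    rw [z.riem_antisymm s γ, z.riem_antisymm β s, z.riem_antisymm β γ s, z.riem_antisymm β γ l]
    ring
  rw [State.nablaRiem, State.nablaRiem, Finset.sum_congr rfl fun s _ => e s,
    Finset.sum_neg_distrib, State.riem_antisymm]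
  ring

/-- Splits off the principal part: with the derivative array set to 0, only the connection terms
remain, and these belong to B. -/
theorem State.nablaRiem_eq (z : State) (f : Fin 3 → Fin 3 → ℝ) (d : Fin 4 → State)
    (α β γ : Fin 4) (Q : Pair) : z.nablaRiem f d α β γ Q.fst Q.snd
      = ofPairs (fun P => d α (.R P Q)) β γ + z.nablaRiem f 0 α β γ Q.fst Q.snd := by
  rw [State.nablaRiem, State.nablaRiem, State.riem_pair, Pi.zero_apply, State.riem_zero]
  ring

/-- The coefficient of the spatial Pfaff derivative `∂_k` in the symmetric form of the system. -/
def spatialPart (k : Fin 3) (d : State) : State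
  | .R (.inl i) Q => -ofPairs (fun P => d (.R P Q)) k.succ i.succ
  | .R (.inr j) Q =>
    (if Pair.snd (.inr j) = k.succ then ofPairs (fun P => d (.R P Q)) 0 (Pair.fst (.inr j)) else 0)
      - if Pair.fst (.inr j) = k.succ then ofPairs (fun P => d (.R P Q)) 0 (Pair.snd (.inr j)) else 0
  | .X h i => if i = k then -d (.Y h) else 0
  | .Y i => -d (.X i k)
  | _ => 0

/-- `spatialPart` as a linear map. -/
def spatialMap (k : Fin 3) : State →ₗ[ℝ] State where
  toFun := spatialPart k
  map_add' d d' := by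
    funext I
    rcases I with ⟨P | P, Q⟩ | _ | _ | _ | _ | _ | _ | _ | _ <;>
      simp only [spatialPart, Pi.add_apply, ofPairs_add] <;> (try split_ifs) <;> ring
  map_smul' r d := by
    funext I
    rcases I with ⟨P | P, Q⟩ | _ | _ | _ | _ | _ | _ | _ | _ <;>
      simp only [spatialPart, Pi.smul_apply, smul_eq_mul, RingHom.id_apply, ofPairs_smul] <;>
      (try split_ifs) <;> ring

/-- Entry by entry, the curl-type terms in the electric equations (for R_{0i}) and the magnetic ones
(for R_{hk}) are transposes of each other, as in Maxwell's equations; likewise -∂_i Y_h in the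
equation for X_{hi} matches -∂_i X_{hi} in that for Y_h. -/
theorem spatialPart_single_symm (k : Fin 3) (I J : Idx) :
    spatialPart k (Pi.single J 1) I = spatialPart k (Pi.single I 1) J := by
  have hR : ∀ P Q P' Q', spatialPart k (Pi.single (.R P' Q') 1) (.R P Q)
      = spatialPart k (Pi.single (.R P Q) 1) (.R P' Q') := by
    intro P Q P' Q'
    -- Components with different second pairs do not couple, so a 6×6 block in the first pair
    -- remains to be checked.
    have e : ∀ P Q Q', (fun P' => (Pi.single (.R P Q) 1 : State) (.R P' Q'))
        = fun P' => (if Q' = Q then 1 else 0) * (Pi.single P 1 : Pair → ℝ) P' := by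
      intro P Q Q'; funext P'
      simp only [Pi.single_apply, Idx.R.injEq]
      split_ifs <;> simp_all
    rcases P with i | i <;> rcases P' with j | j <;>
      simp only [spatialPart, e, ofPairs_smul, eq_comm (a := Q) (b := Q')] <;>
      rcases eq_or_ne Q' Q with h | h <;> simp only [h, if_true, if_false, zero_mul, one_mul, neg_zero, ite_self, sub_zero]
    all_goals fin_cases k <;> fin_cases i <;> fin_cases j <;>
      simp [ofPairs, Pair.fst, Pair.snd]
  rcases I with ⟨P | P, Q⟩ | _ | _ | _ | _ | _ | _ | _ | _ <;>
    rcases J with ⟨P' | P', Q'⟩ | _ | _ | _ | _ | _ | _ | _ | _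
  any_goals exact hR _ _ _ _
  all_goals simp [spatialPart, Pi.single_apply, ofPairs_zero]
  all_goals grind

/-- The matrices `M^α` of the symmetric form of the system. -/
noncomputable def symbol (E : EquationOfState) (α : Fin 4) (z : State) : Matrix Idx Idx ℝ :=
  Fin.cases (motive := fun _ => Matrix Idx Idx ℝ)
    (Matrix.diagonal fun I => match I with | .Y _ => z.muP E | _ => 1)
    (fun k => LinearMap.toMatrix' (spatialMap k)) α

/-- The value of the Pfaff derivative `∂_α U` in terms of the gauge functions. -/
noncomputable def GaugeJet.pfaffU (g : GaugeJet) (z : State) (α : Fin 4) : ℝ :=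
  ∑ m, z.frame g.1 α m * g.2.1 m

/-- The value of the Pfaff derivative `∂_α f_{ij}` in terms of the gauge functions. -/
noncomputable def GaugeJet.pfaffF (g : GaugeJet) (z : State) (α : Fin 4) (i j : Fin 3) : ℝ :=
  ∑ m, z.frame g.1 α m * g.2.2.2 m i j

/-- The right-hand side `B` of the symmetric form of the system. -/
noncomputable def source (E : EquationOfState) (g : GaugeJet) (z : State) : State
  | .R (.inl i) Q => -z.nablaRiem g.2.2.1 0 0 0 i.succ Q.fst Q.snd
      + ∑ h : Fin 3, z.nablaRiem g.2.2.1 0 h.succ h.succ i.succ Q.fst Q.snd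
      - z.sourceJ E g.2.2.1 i.succ Q.fst Q.snd
  | .R (.inr j) Q =>
      -(z.nablaRiem g.2.2.1 0 0 (Pair.fst (.inr j)) (Pair.snd (.inr j)) Q.fst Q.snd
        + z.nablaRiem g.2.2.1 0 (Pair.snd (.inr j)) 0 (Pair.fst (.inr j)) Q.fst Q.snd
        - z.nablaRiem g.2.2.1 0 (Pair.fst (.inr j)) 0 (Pair.snd (.inr j)) Q.fst Q.snd)
  | .a i j => ∑ k : Fin 3, z (.a k j) * (z (.X k i) - g.2.2.1 k i)
  | .b i => (∑ h : Fin 3, z (.a h i) * (-z (.Y h) + g.1⁻¹ * g.pfaffU z h.succ))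
      + g.1⁻¹ * z (.b i) * g.pfaffU z 0
  | .w h j i => g.pfaffF z h.succ j i - quadCurv (z.conn g.2.2.1) 0 h.succ i.succ j.succ
      + z.riem 0 h.succ i.succ j.succ
  | .X h i => -z.curlG E g.2.2.1 h.succ i.succ + quadCurv (z.conn g.2.2.1) h.succ 0 i.succ 0
      - z.riem h.succ 0 i.succ 0
  | .Y i => -(z.muP E * z.curlG E g.2.2.1 0 i.succ) + z.dmuP E i.succ * z.G E 0
      + ∑ k : Fin 3, quadCurv (z.conn g.2.2.1) k.succ i.succ k.succ 0
  | .mu => -((z .mu + z.pressure E) * z.trX)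
  | .S => 0
  | .dS k => ∑ j : Fin 3, (g.2.2.1 k j - z (.X k j)) * z (.dS j)

theorem symbol_mulVec (E : EquationOfState) (z : State) (d : Fin 4 → State) (I : Idx) :
    (∑ α, (symbol E α z).mulVec (d α)) I
      = (match I with | .Y _ => z.muP E | _ => 1) * d 0 I
        + ∑ k : Fin 3, spatialPart k (d k.succ) I := by
  rw [Fin.sum_univ_succ, Pi.add_apply, Finset.sum_apply]
  congr 1
  · exact Matrix.mulVec_diagonal _ _ _
  · refine Finset.sum_congr rfl fun k _ => ?_
    change ((LinearMap.toMatrix' (spatialMap k)).mulVec (d k.succ)) I = _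
    rw [LinearMap.toMatrix'_mulVec]
    rfl

theorem symbol_isSymm (E : EquationOfState) (z : State) (α : Fin 4) : (symbol E α z).IsSymm := by
  induction α using Fin.cases with
  | zero => exact Matrix.isSymm_diagonal _
  | succ k =>
    refine Matrix.IsSymm.ext fun I J => ?_
    change LinearMap.toMatrix' (spatialMap k) J I = LinearMap.toMatrix' (spatialMap k) I J
    rw [LinearMap.toMatrix'_apply, LinearMap.toMatrix'_apply]
    exact spatialPart_single_symm k J I

theorem symbol_zero_posDef (E : EquationOfState) {z : State} (hz : 0 < z.muP E) :
    (symbol E 0 z).PosDef := by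
  refine Matrix.PosDef.diagonal fun I => ?_
  cases I <;> first | exact hz | exact one_pos

/-- The left-hand side is antisymmetric in h and k, so the nine equations reduce to three, one for
each magnetic unknown. -/
theorem bianchi_iff (z : State) (f : Fin 3 → Fin 3 → ℝ) (d : Fin 4 → State) (l μ : Fin 4) :
    (∀ h k : Fin 3, z.nablaRiem f d 0 h.succ k.succ l μ + z.nablaRiem f d k.succ 0 h.succ l μ
        - z.nablaRiem f d h.succ 0 k.succ l μ = 0) ↔
      ∀ j : Fin 3, z.nablaRiem f d 0 (Pair.fst (.inr j)) (Pair.snd (.inr j)) l μ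
        + z.nablaRiem f d (Pair.snd (.inr j)) 0 (Pair.fst (.inr j)) l μ
        - z.nablaRiem f d (Pair.fst (.inr j)) 0 (Pair.snd (.inr j)) l μ = 0 := by
  constructor
  · intro H j
    fin_cases j
    · exact H 1 2
    · exact H 2 0
    · exact H 0 1
  · intro H h k
    have h0 := H 0
    have h1 := H 1
    have h2 := H 2
    have ha := fun β γ => z.nablaRiem_antisymm f d 0 β γ l μ
    have hd : ∀ β, z.nablaRiem f d 0 β β l μ = 0 := fun β => by linarith [ha β β]
    have a0 := ha 2 3
    have a1 := ha 3 1
    have a2 := ha 1 2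
    simp only [Pair.fst, Pair.snd, Sum.elim_inr, Matrix.cons_val] at h0 h1 h2
    fin_cases h <;> fin_cases k <;> simp [hd, -Fin.isValue] <;> linarith

theorem spatialPart_electric (d : Fin 4 → State) (i : Fin 3) (Q : Pair) :
    ∑ k : Fin 3, spatialPart k (d k.succ) (.R (.inl i) Q)
      = -∑ k : Fin 3, ofPairs (fun P => d k.succ (.R P Q)) k.succ i.succ := by
  simp [spatialPart]

theorem spatialPart_magnetic (d : Fin 4 → State) (j : Fin 3) (Q : Pair) :
    ∑ k : Fin 3, spatialPart k (d k.succ) (.R (.inr j) Q)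
      = ofPairs (fun P => d (Pair.snd (.inr j)) (.R P Q)) 0 (Pair.fst (.inr j))
        - ofPairs (fun P => d (Pair.fst (.inr j)) (.R P Q)) 0 (Pair.snd (.inr j)) := by
  fin_cases j <;> simp [spatialPart, Pair.fst, Pair.snd, Fin.sum_univ_three]

/-! ### Each EEF equation as a row of the symmetric system -/

section EquationByEquation

variable (E : EquationOfState) (U : Pt → ℝ) (f : Pt → Fin 3 → Fin 3 → ℝ) (v : Pt → State) (x : Pt)

theorem bianchi_iff_symbol (Q : Pair) (j : Fin 3) :
    ((v x).nablaRiem (f x) (pfaffState U v x) 0 (Pair.fst (.inr j)) (Pair.snd (.inr j)) Q.fst Q.snd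
        + (v x).nablaRiem (f x) (pfaffState U v x) (Pair.snd (.inr j)) 0 (Pair.fst (.inr j))
          Q.fst Q.snd
        - (v x).nablaRiem (f x) (pfaffState U v x) (Pair.fst (.inr j)) 0 (Pair.snd (.inr j))
          Q.fst Q.snd = 0) ↔
      1 * pfaffState U v x 0 (.R (.inr j) Q)
        + ∑ k : Fin 3, spatialPart k (pfaffState U v x k.succ) (.R (.inr j) Q)
        = source E (gaugeJet U f x) (v x) (.R (.inr j) Q) := by
  have hs : source E (gaugeJet U f x) (v x) (.R (.inr j) Q)
      = -((v x).nablaRiem (f x) 0 0 (Pair.fst (.inr j)) (Pair.snd (.inr j)) Q.fst Q.snd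
        + (v x).nablaRiem (f x) 0 (Pair.snd (.inr j)) 0 (Pair.fst (.inr j)) Q.fst Q.snd
        - (v x).nablaRiem (f x) 0 (Pair.fst (.inr j)) 0 (Pair.snd (.inr j)) Q.fst Q.snd) := rfl
  rw [hs, spatialPart_magnetic, State.nablaRiem_eq _ _ (pfaffState U v x),
    State.nablaRiem_eq _ _ (pfaffState U v x), State.nablaRiem_eq _ _ (pfaffState U v x),
    ofPairs_pair]
  constructor <;> intro h <;> linear_combination h

theorem bianchi_contracted_iff_symbol (Q : Pair) (i : Fin 3) :
    (-(v x).nablaRiem (f x) (pfaffState U v x) 0 0 i.succ Q.fst Q.snd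
        + ∑ h : Fin 3, (v x).nablaRiem (f x) (pfaffState U v x) h.succ h.succ i.succ Q.fst Q.snd
        = (v x).sourceJ E (f x) i.succ Q.fst Q.snd) ↔
      1 * pfaffState U v x 0 (.R (.inl i) Q)
        + ∑ k : Fin 3, spatialPart k (pfaffState U v x k.succ) (.R (.inl i) Q)
        = source E (gaugeJet U f x) (v x) (.R (.inl i) Q) := by
  have hs : source E (gaugeJet U f x) (v x) (.R (.inl i) Q)
      = -(v x).nablaRiem (f x) 0 0 0 i.succ Q.fst Q.snd
        + ∑ h : Fin 3, (v x).nablaRiem (f x) 0 h.succ h.succ i.succ Q.fst Q.snd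
        - (v x).sourceJ E (f x) i.succ Q.fst Q.snd := rfl
  have h0 : ofPairs (fun P => pfaffState U v x 0 (.R P Q)) 0 i.succ
      = pfaffState U v x 0 (.R (.inl i) Q) := by
    fin_cases i <;> rfl
  simp only [State.nablaRiem_eq _ _ (pfaffState U v x), spatialPart_electric, hs,
    Finset.sum_add_distrib, h0]
  -- The contracted equation carries -∂_0 R_{0i}; reversing its sign makes the diagonal entry of M^0
  -- equal to 1 and the spatial part the transpose of the magnetic one.
  constructor <;> intro h <;> linear_combination -h

theorem connection_w_iff_symbol (h j i : Fin 3) :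
    (pfaffState U v x 0 (.w h j i) - pfaff ((v x).frame (U x)) h.succ (fun y => f y j i) x
        + quadCurv ((v x).conn (f x)) 0 h.succ i.succ j.succ
        = (v x).riem 0 h.succ i.succ j.succ) ↔
      1 * pfaffState U v x 0 (.w h j i)
        + ∑ k : Fin 3, spatialPart k (pfaffState U v x k.succ) (.w h j i)
        = source E (gaugeJet U f x) (v x) (.w h j i) := by
  have hs : source E (gaugeJet U f x) (v x) (.w h j i)
      = pfaff ((v x).frame (U x)) h.succ (fun y => f y j i) x
        - quadCurv ((v x).conn (f x)) 0 h.succ i.succ j.succ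
        + (v x).riem 0 h.succ i.succ j.succ := rfl
  simp only [spatialPart, Finset.sum_const_zero, hs]
  constructor <;> intro h <;> linear_combination h

theorem connection_X_iff_symbol (h i : Fin 3) :
    (pfaffState U v x 0 (.X h i) - pfaffState U v x i.succ (.Y h)
        = -(v x).curlG E (f x) h.succ i.succ + quadCurv ((v x).conn (f x)) h.succ 0 i.succ 0
          - (v x).riem h.succ 0 i.succ 0) ↔
      1 * pfaffState U v x 0 (.X h i)
        + ∑ k : Fin 3, spatialPart k (pfaffState U v x k.succ) (.X h i)
        = source E (gaugeJet U f x) (v x) (.X h i) := by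
  have hs : source E (gaugeJet U f x) (v x) (.X h i)
      = -(v x).curlG E (f x) h.succ i.succ + quadCurv ((v x).conn (f x)) h.succ 0 i.succ 0
          - (v x).riem h.succ 0 i.succ 0 := rfl
  have hX : ∑ k : Fin 3, spatialPart k (pfaffState U v x k.succ) (.X h i)
      = -pfaffState U v x i.succ (.Y h) := by
    simp [spatialPart]
  rw [hs, hX, one_mul, ← sub_eq_add_neg]

theorem connection_Y_iff_symbol (i : Fin 3) :
    ((v x).muP E * pfaffState U v x 0 (.Y i) - ∑ k : Fin 3, pfaffState U v x k.succ (.X i k)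
        = -((v x).muP E * (v x).curlG E (f x) 0 i.succ) + (v x).dmuP E i.succ * (v x).G E 0
          + ∑ k : Fin 3, quadCurv ((v x).conn (f x)) k.succ i.succ k.succ 0) ↔
      (v x).muP E * pfaffState U v x 0 (.Y i)
        + ∑ k : Fin 3, spatialPart k (pfaffState U v x k.succ) (.Y i)
        = source E (gaugeJet U f x) (v x) (.Y i) := by
  have hs : source E (gaugeJet U f x) (v x) (.Y i)
      = -((v x).muP E * (v x).curlG E (f x) 0 i.succ) + (v x).dmuP E i.succ * (v x).G E 0
          + ∑ k : Fin 3, quadCurv ((v x).conn (f x)) k.succ i.succ k.succ 0 := rfl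
  have hY : ∑ k : Fin 3, spatialPart k (pfaffState U v x k.succ) (.Y i)
      = -∑ k : Fin 3, pfaffState U v x k.succ (.X i k) := by
    simp [spatialPart]
  rw [hs, hY, ← sub_eq_add_neg]

theorem eq_source_iff_symbol (I : Idx) (h0 : ∀ k d, spatialPart k d I = 0) :
    (pfaffState U v x 0 I = source E (gaugeJet U f x) (v x) I) ↔
      1 * pfaffState U v x 0 I + ∑ k : Fin 3, spatialPart k (pfaffState U v x k.succ) I
        = source E (gaugeJet U f x) (v x) I := by
  simp only [h0, Finset.sum_const_zero, one_mul, add_zero]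

theorem eefSystem_iff : EEFSystem E U f v x ↔
    ∑ α, (symbol E α (v x)).mulVec (pfaffState U v x α) = source E (gaugeJet U f x) (v x) := by
  rw [funext_iff]
  simp only [symbol_mulVec]
  have h1 := eq_source_iff_symbol E U f v x
  constructor
  · intro H I
    rcases I with ⟨i | j, Q⟩ | ⟨i, j⟩ | i | ⟨h, j, i⟩ | ⟨h, i⟩ | i | _ | _ | k
    · exact (bianchi_contracted_iff_symbol E U f v x Q i).mp (H.bianchi_contracted Q i)
    · exact (bianchi_iff_symbol E U f v x Q j).mp ((bianchi_iff _ _ _ _ _).mp (H.bianchi Q) j)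
    · exact (h1 (.a i j) fun _ _ => rfl).mp (H.frame_a i j)
    · exact (h1 (.b i) fun _ _ => rfl).mp (H.frame_b i)
    · exact (connection_w_iff_symbol E U f v x h j i).mp (H.connection_w h j i)
    · exact (connection_X_iff_symbol E U f v x h i).mp (H.connection_X h i)
    · exact (connection_Y_iff_symbol E U f v x i).mp (H.connection_Y i)
    · exact (h1 .mu fun _ _ => rfl).mp (eq_neg_of_add_eq_zero_left H.matter_mu)
    · exact (h1 .S fun _ _ => rfl).mp H.matter_S
    · exact (h1 (.dS k) fun _ _ => rfl).mp (H.matter_dS k)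
  · intro H
    exact
      { bianchi := fun Q => (bianchi_iff _ _ _ _ _).mpr fun j =>
          (bianchi_iff_symbol E U f v x Q j).mpr (H (.R (.inr j) Q))
        bianchi_contracted := fun Q i =>
          (bianchi_contracted_iff_symbol E U f v x Q i).mpr (H (.R (.inl i) Q))
        frame_a := fun i j => (h1 (.a i j) fun _ _ => rfl).mpr (H (.a i j))
        frame_b := fun i => (h1 (.b i) fun _ _ => rfl).mpr (H (.b i))
        connection_w := fun h j i => (connection_w_iff_symbol E U f v x h j i).mpr (H (.w h j i))
        connection_X := fun h i => (connection_X_iff_symbol E U f v x h i).mpr (H (.X h i))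
        connection_Y := fun i => (connection_Y_iff_symbol E U f v x i).mpr (H (.Y i))
        matter_mu := eq_neg_iff_add_eq_zero.mp ((h1 .mu fun _ _ => rfl).mpr (H .mu))
        matter_S := (h1 .S fun _ _ => rfl).mpr (H .S)
        matter_dS := fun k => (h1 (.dS k) fun _ _ => rfl).mpr (H (.dS k)) }

end EquationByEquation

/-! ### Smoothness of the coefficients -/

section Smoothness

variable {E : EquationOfState}

theorem pressure_mem_dom (hmu : ∀ p s, (p, s) ∈ E.dom → 0 < E.muP p s) {z : State}
    (hz : z ∈ admissible E) : (z.pressure E, z .S) ∈ E.dom := by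
  obtain ⟨-, p, hp, h⟩ := hz
  rw [State.pressure, ← h, EquationOfState.pressure_mu hmu hp]
  exact hp

theorem mu_pressure (hmu : ∀ p s, (p, s) ∈ E.dom → 0 < E.muP p s) {z : State}
    (hz : z ∈ admissible E) : E.mu (z.pressure E) (z .S) = z .mu := by
  obtain ⟨-, p, hp, h⟩ := hz
  rw [State.pressure, ← h, EquationOfState.pressure_mu hmu hp]

theorem contDiffOn_pressure (hmu : ∀ p s, (p, s) ∈ E.dom → 0 < E.muP p s) :
    ContDiffOn ℝ ∞ (fun z : State => z.pressure E) (admissible E) := by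
  rintro z ⟨-, p, hp, h⟩
  have h1 := EquationOfState.contDiffAt_pressure hmu hp
  rw [h] at h1
  have h2 : ContDiffAt ℝ ∞ (fun z : State => (z .mu, z .S)) z := by fun_prop
  exact (ContDiffAt.comp z (g := fun q : ℝ × ℝ => E.pressure q.1 q.2) h1 h2).contDiffWithinAt

/-- A function of `(p, S)` which is smooth on the admissible set gives a smooth function of the
unknowns. -/
theorem contDiffOn_comp_pressure (hmu : ∀ p s, (p, s) ∈ E.dom → 0 < E.muP p s) {F : ℝ → ℝ → ℝ}
    (hF : ContDiffOn ℝ ∞ (fun q : ℝ × ℝ => F q.1 q.2) E.dom) :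
    ContDiffOn ℝ ∞ (fun z : State => F (z.pressure E) (z .S)) (admissible E) :=
  hF.comp ((contDiffOn_pressure hmu).prodMk (by fun_prop)) fun _ hz => pressure_mem_dom hmu hz

theorem contDiffOn_symbol (hmu : ∀ p s, (p, s) ∈ E.dom → 0 < E.muP p s) (α : Fin 4) (I J : Idx) :
    ContDiffOn ℝ ∞ (fun z => symbol E α z I J) (admissible E) := by
  induction α using Fin.cases with
  | zero =>
    simp only [symbol, Fin.cases_zero, Matrix.diagonal_apply]
    split_ifs
    · split
      · exact contDiffOn_comp_pressure hmu EquationOfState.contDiffOn_muP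
      · exact contDiffOn_const
    · exact contDiffOn_const
  | succ k => exact contDiffOn_const

/-- The set of gauge jets and states at which the right-hand side is smooth. -/
def sourceDomain (E : EquationOfState) : Set (GaugeJet × State) :=
  {q | q.1.1 ≠ 0 ∧ q.2 ∈ admissible E}

/-- Smooth functions of the gauge functions, of their first derivatives and of the unknowns. -/
def SmoothSource (E : EquationOfState) (φ : GaugeJet → State → ℝ) : Prop :=
  ContDiffOn ℝ ∞ (fun q : GaugeJet × State => φ q.1 q.2) (sourceDomain E)

namespace SmoothSource

variable {φ ψ : GaugeJet → State → ℝ}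

theorem add (hφ : SmoothSource E φ) (hψ : SmoothSource E ψ) :
    SmoothSource E fun g z => φ g z + ψ g z := ContDiffOn.add hφ hψ

theorem sub (hφ : SmoothSource E φ) (hψ : SmoothSource E ψ) :
    SmoothSource E fun g z => φ g z - ψ g z := ContDiffOn.sub hφ hψ

theorem mul (hφ : SmoothSource E φ) (hψ : SmoothSource E ψ) :
    SmoothSource E fun g z => φ g z * ψ g z := ContDiffOn.mul hφ hψ

theorem neg (hφ : SmoothSource E φ) : SmoothSource E fun g z => -φ g z := ContDiffOn.neg hφ

theorem div (hφ : SmoothSource E φ) (hψ : SmoothSource E ψ)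
    (h0 : ∀ g z, z ∈ admissible E → ψ g z ≠ 0) :
    SmoothSource E fun g z => φ g z / ψ g z := ContDiffOn.div hφ hψ fun _ hq => h0 _ _ hq.2

theorem sum {ι : Type*} [Fintype ι] {φ : ι → GaugeJet → State → ℝ}
    (hφ : ∀ i, SmoothSource E (φ i)) : SmoothSource E fun g z => ∑ i, φ i g z :=
  ContDiffOn.sum fun i _ => hφ i

theorem const (r : ℝ) : SmoothSource E fun _ _ => r := contDiffOn_const

theorem of_state {χ : State → ℝ} (h : ContDiffOn ℝ ∞ χ (admissible E)) :
    SmoothSource E fun _ z => χ z := h.comp contDiffOn_snd fun _ hq => hq.2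

theorem state (I : Idx) : SmoothSource E fun _ z => z I :=
  of_state (χ := fun z => z I) (by fun_prop)

theorem gauge {χ : GaugeJet → ℝ} (h : ContDiff ℝ ∞ χ) : SmoothSource E fun g _ => χ g :=
  (h.comp contDiff_fst).contDiffOn

theorem rotation (i j : Fin 3) : SmoothSource E fun g _ => g.2.2.1 i j :=
  gauge (χ := fun g => g.2.2.1 i j) (by fun_prop)

theorem inv_lapse : SmoothSource E fun g _ => g.1⁻¹ :=
  ContDiffOn.inv (f := fun q : GaugeJet × State => q.1.1) (by fun_prop) fun _ hq => hq.1

theorem frame (α m : Fin 4) : SmoothSource E fun g z => z.frame g.1 α m :=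
  contDiffOn_frame (U := fun q : GaugeJet × State => q.1.1)
    (a := fun q i j => q.2 (.a i j)) (b := fun q i => q.2 (.b i)) (by fun_prop)
    (fun _ hq => hq.1) (by fun_prop) (fun _ hq => hq.2.1) (by fun_prop) α m

theorem pfaffU (α : Fin 4) : SmoothSource E fun g z => g.pfaffU z α :=
  .sum fun m => (frame α m).mul (gauge (χ := fun g => g.2.1 m) (by fun_prop))

theorem pfaffF (α : Fin 4) (i j : Fin 3) : SmoothSource E fun g z => g.pfaffF z α i j :=
  .sum fun m => (frame α m).mul (gauge (χ := fun g => g.2.2.2 m i j) (by fun_prop))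

theorem conn (α β γ : Fin 4) : SmoothSource E fun g z => z.conn g.2.2.1 α β γ := by
  induction α using Fin.cases <;> induction β using Fin.cases <;> induction γ using Fin.cases <;>
    simp only [State.conn, Fin.cons_zero, Fin.cons_succ]
  exacts [const 0, state _, state _, rotation _ _, const 0, state _, state _, state _]

theorem riem (α β l μ : Fin 4) : SmoothSource E fun _ z => z.riem α β l μ := by
  have h : ∀ (ψ : Pair → State → ℝ), (∀ P, SmoothSource E fun _ z => ψ P z) →
      ∀ α β, SmoothSource E fun _ z => ofPairs (fun P => ψ P z) α β := by
    intro ψ hψ α β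
    fin_cases α <;> fin_cases β <;>
      first | exact const 0 | exact hψ _ | exact (hψ _).neg
  exact h _ (fun P => h (fun Q z => z (.R P Q)) (fun Q => state _) l μ) α β

theorem quadCurv (l μ α β : Fin 4) :
    SmoothSource E fun g z => EEF.quadCurv (z.conn g.2.2.1) l μ α β :=
  .sum fun _ => (((conn _ _ _).mul ((conn _ _ _).sub (conn _ _ _))).neg.add
    ((conn _ _ _).mul (conn _ _ _))).sub ((conn _ _ _).mul (conn _ _ _))

theorem nablaRiem (α β γ l μ : Fin 4) :
    SmoothSource E fun g z => z.nablaRiem g.2.2.1 0 α β γ l μ :=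
  .sub (.of_state (χ := fun _ => State.riem 0 β γ l μ) contDiffOn_const) <| .sum fun _ =>
    ((((conn _ _ _).mul (riem _ _ _ _)).add ((conn _ _ _).mul (riem _ _ _ _))).add
      ((conn _ _ _).mul (riem _ _ _ _))).add ((conn _ _ _).mul (riem _ _ _ _))

theorem dS (α : Fin 4) : SmoothSource E fun _ z => z.dS α := by
  induction α using Fin.cases
  exacts [const 0, state _]

theorem trX : SmoothSource E fun _ z => z.trX := .sum fun _ => state _

theorem muP (hmu : ∀ p s, (p, s) ∈ E.dom → 0 < E.muP p s) :
    SmoothSource E fun _ z => z.muP E :=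
  .of_state (contDiffOn_comp_pressure hmu EquationOfState.contDiffOn_muP)

theorem muS (hmu : ∀ p s, (p, s) ∈ E.dom → 0 < E.muP p s) :
    SmoothSource E fun _ z => E.muS (z.pressure E) (z .S) :=
  .of_state (contDiffOn_comp_pressure hmu EquationOfState.contDiffOn_muS)

theorem pressure (hmu : ∀ p s, (p, s) ∈ E.dom → 0 < E.muP p s) :
    SmoothSource E fun _ z => z.pressure E := .of_state (contDiffOn_pressure hmu)

theorem enthalpy (hmu : ∀ p s, (p, s) ∈ E.dom → 0 < E.muP p s) :
    SmoothSource E fun _ z => z .mu + z.pressure E := (state _).add (pressure hmu)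

theorem G (hmu : ∀ p s, (p, s) ∈ E.dom → 0 < E.muP p s) (α : Fin 4) :
    SmoothSource E fun _ z => z.G E α := by
  induction α using Fin.cases
  · exact (trX.div (muP hmu) fun _ z hz => (hmu _ _ (pressure_mem_dom hmu hz)).ne').neg
  · exact (state _).neg

theorem dp (hmu : ∀ p s, (p, s) ∈ E.dom → 0 < E.muP p s) (α : Fin 4) :
    SmoothSource E fun _ z => z.dp E α := (enthalpy hmu).mul (G hmu α)

theorem dmu (hmu : ∀ p s, (p, s) ∈ E.dom → 0 < E.muP p s) (α : Fin 4) :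
    SmoothSource E fun _ z => z.dmu E α :=
  ((muP hmu).mul (dp hmu α)).add ((muS hmu).mul (dS α))

theorem dmuP (hmu : ∀ p s, (p, s) ∈ E.dom → 0 < E.muP p s) (α : Fin 4) :
    SmoothSource E fun _ z => z.dmuP E α :=
  (SmoothSource.mul (.of_state (contDiffOn_comp_pressure hmu EquationOfState.contDiffOn_muPP))
    (dp hmu α)).add
  (SmoothSource.mul (.of_state (contDiffOn_comp_pressure hmu EquationOfState.contDiffOn_muPS))
    (dS α))

theorem curlG (hmu : ∀ p s, (p, s) ∈ E.dom → 0 < E.muP p s)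
    (hne : ∀ p s, (p, s) ∈ E.dom → E.mu p s + p ≠ 0) (α β : Fin 4) :
    SmoothSource E fun g z => z.curlG E g.2.2.1 α β := by
  refine .sub (.sum fun γ => ((conn _ _ _).sub (conn _ _ _)).mul (G hmu _)) <|
    ((muS hmu).div (enthalpy hmu) fun _ z hz => ?_).mul
      (((dS _).mul (G hmu _)).sub ((dS _).mul (G hmu _)))
  rw [← mu_pressure hmu hz]
  exact hne _ _ (pressure_mem_dom hmu hz)

theorem rho {m p : GaugeJet → State → ℝ} (hm : SmoothSource E m) (hp : SmoothSource E p)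
    (α β : Fin 4) : SmoothSource E fun g z => EEF.rho (m g z) (p g z) α β :=
  ((((hm.add hp).mul (const _)).mul (const _))).add (((const _).mul (hm.sub hp)).mul (const _))

theorem nablaRho (hmu : ∀ p s, (p, s) ∈ E.dom → 0 < E.muP p s) (α β γ : Fin 4) :
    SmoothSource E fun g z => z.nablaRho E g.2.2.1 α β γ :=
  have hr := fun β γ => rho (state (E := E) .mu) (pressure hmu) β γ
  (rho (dmu hmu α) (dp hmu α) β γ).sub <| .sum fun _ =>
    ((conn _ _ _).mul (hr _ _)).add ((conn _ _ _).mul (hr _ _))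

theorem source (hmu : ∀ p s, (p, s) ∈ E.dom → 0 < E.muP p s)
    (hne : ∀ p s, (p, s) ∈ E.dom → E.mu p s + p ≠ 0) (I : Idx) :
    SmoothSource E fun g z => EEF.source E g z I := by
  rcases I with ⟨i | j, Q⟩ | ⟨i, j⟩ | i | ⟨h, j, i⟩ | ⟨h, i⟩ | i | _ | _ | k
  · exact ((nablaRiem _ _ _ _ _).neg.add (.sum fun _ => nablaRiem _ _ _ _ _)).sub
      ((nablaRho hmu _ _ _).sub (nablaRho hmu _ _ _))
  · exact (((nablaRiem _ _ _ _ _).add (nablaRiem _ _ _ _ _)).sub (nablaRiem _ _ _ _ _)).neg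
  · exact .sum fun _ => (state _).mul ((state _).sub (rotation _ _))
  · exact .add (.sum fun _ => (state _).mul ((state _).neg.add (inv_lapse.mul (pfaffU _))))
      ((inv_lapse.mul (state _)).mul (pfaffU _))
  · exact ((pfaffF _ _ _).sub (quadCurv _ _ _ _)).add (riem _ _ _ _)
  · exact ((curlG hmu hne _ _).neg.add (quadCurv _ _ _ _)).sub (riem _ _ _ _)
  · exact (((muP hmu).mul (curlG hmu hne _ _)).neg.add ((dmuP hmu _).mul (G hmu _))).add
      (.sum fun _ => quadCurv _ _ _ _)
  · exact ((enthalpy hmu).mul trX).neg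
  · exact const 0
  · exact .sum fun _ => ((rotation _ _).sub (state _)).mul (state _)

end SmoothSource

theorem isQuasiFOSH_eefSystem (hmu : ∀ p s, (p, s) ∈ E.dom → 0 < E.muP p s)
    (hne : ∀ p s, (p, s) ∈ E.dom → E.mu p s + p ≠ 0) :
    IsQuasiFOSH (admissible E) (EEFSystem E) :=
  ⟨symbol E, source E, contDiffOn_symbol hmu, SmoothSource.source hmu hne,
    fun z _ α => symbol_isSymm E z α,
    fun _ hz => symbol_zero_posDef E (hmu _ _ (pressure_mem_dom hmu hz)),
    fun U f v x _ _ => eefSystem_iff E U f v x⟩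

end Smoothness

end EEF

theorem mainTheorem1 (E : EEF.EquationOfState)
    (hmu : ∀ p s, (p, s) ∈ E.dom → 0 < E.muP p s)
    (hne : ∀ p s, (p, s) ∈ E.dom → E.mu p s + p ≠ 0) :
    EEF.IsQuasiFOSH (EEF.admissible E) (EEF.EEFSystem E) ∧
    ∀ (Ω : Set EEF.Pt), IsOpen Ω →
      ∀ (U : EEF.Pt → ℝ) (f : EEF.Pt → Fin 3 → Fin 3 → ℝ)
        (a : EEF.Pt → Fin 3 → Fin 3 → ℝ) (b : EEF.Pt → Fin 3 → ℝ) (p S : EEF.Pt → ℝ),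
        EEF.IsEinsteinEuler E Ω U a b p S →
        (∀ x ∈ Ω, ∀ i j : Fin 3, EEF.cfConn U a b x 0 i.succ j.succ = f x i j) →
        ∀ x ∈ Ω, EEF.unknowns E U a b p S x ∈ EEF.admissible E ∧
          EEF.EEFSystem E U f (EEF.unknowns E U a b p S) x := by
  refine ⟨EEF.isQuasiFOSH_eefSystem hmu hne, fun Ω hΩ U f a b p S h hf x hx => ⟨?_, ?_⟩⟩
  · exact ⟨h.det_ne_zero x hx, p x, h.mem_dom x hx, rfl⟩
  · exact h.eefSystem hΩ hmu hne hf hx
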